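/- Let $\Gamma\subset \mathrm O(4)$ be a finite group and let $f:\mathbb R^4\to\mathbb R^4$ be a $C^1$ (for instance smooth) $\Gamma$-equivariant vector field. Indices $j$ are taken modulo $M$. Let $\xi_1,\dots,\xi_M$ be hyperbolic equilibria of $\dot x=f(x)$ with $\xi_j\ne\xi_{j+1}$ and $\kappa_j=W^u(\xi_j)\cap W^s(\xi_{j+1})\neq\emptyset$ for all $j$. Suppose that this heteroclinic cycle $\bigcup_j(\{\xi_j\}\cup\kappa_j)$ is robust: for each $j$ there is a subgroup $\Sigma_j\subset\Gamma$ such that, with $P_j=\mathrm{Fix}(\Sigma_j)$, the equilibria $\xi_j,\xi_{j+1}$ and the connection $\kappa_j$ lie in $P_j$, and $\xi_{j+1}$ is a sink in $P_j$ (all eigenvalues of $df(\xi_{j+1})|_{P_j}$ have negative real part). Put $L_j=P_{j-1}\cap P_j$ and let $\Delta_j$ be the subgroup of all elements of $\Gamma$ that fix $L_j$ pointwise, so that $L_j=\mathrm{Fix}(\Delta_j)$. Assume that for all $j$: (i) $\dim P_j=2$; (ii) each connected component of $L_j\setminus\{0\}$ contains at most one point of the heteroclinic cycle. Let $j$ be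 such that $L_j\neq\{0\}$ (which is automatic if $\xi_j\ne0$; in that case $\Delta_j$ is the isotropy group of $\xi_j$). Let $V_j$ and $W_j$ be the orthogonal complements of $L_j$ in $P_{j-1}$ and in $P_j$, respectively, let $T_j=(L_j+V_j+W_j)^\perp$, and let $J_j=df(\xi_j)$. Then $L_j,V_j,W_j,T_j$ are one-dimensional and consist of eigenvectors (and $0$) of $J_j$, with real eigenvalues $r_j$, $-c_j$, $e_j$, $t_j$ respectively, where $c_j>0$ and $e_j>0$. Moreover the isotypic decomposition of the representation of $\Delta_j$ in $\mathbb R^4$ is of one of the following types, where $\oplus^\perp$ denotes an orthogonal direct sum: 1. $L_j\oplus^\perp V_j\oplus^\perp W_j\oplus^\perp T_j$; 2. $L_j\oplus^\perp V_j\oplus^\perp \widetilde W_j$, where $\widetilde W_j=W_j\oplus T_j$ has dimension 2; 3. $L_j\oplus^\perp \widetilde V_j\oplus^\perp W_j$, where $\widetilde V_j=V_j\oplus T_j$ has dimension 2. In cases 2 and 3, $\Delta_j$ acts in $\widetilde W_j$ (resp. $\widetilde V_j$) as a dihedral group $\mathbb D_m$ for some $m\ge3$, that is, as the symmetry group of a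 regular $m$-gon. In case 2, $e_j=t_j$ and $e_j$ is a double eigenvalue of $J_j$. In case 3, $-c_j=t_j$ and $-c_j$ is a double eigenvalue of the restriction of $J_j$ to $L_j^\perp$; hence it is a double eigenvalue of $J_j$ unless it happens to coincide with the radial eigenvalue $r_j$. -/

import Mathlib

open Filter Topology Set

noncomputable section

/-- Euclidean `ℝ⁴`. -/
abbrev R4 : Type := EuclideanSpace ℝ (Fin 4)

/-- The orthogonal group `O(4)`, as the group of linear isometries of `ℝ⁴`. -/
abbrev O4 : Type := R4 ≃ₗᵢ[ℝ] R4

/-! ### Group actions -/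

/-- `f` is `Γ`-equivariant. -/
def IsEquivariant (Γ : Subgroup O4) (f : R4 → R4) : Prop :=
  ∀ γ ∈ Γ, ∀ x, f (γ x) = γ (f x)

/-- The fixed-point subspace `Fix(H)`. -/
def fixSpace (H : Subgroup O4) : Submodule ℝ R4 where
  carrier := {x | ∀ h ∈ H, h x = x}
  add_mem' := fun {a b} ha hb h hh => by rw [map_add, ha h hh, hb h hh]
  zero_mem' := fun h _ => map_zero h
  smul_mem' := fun c x hx h hh => by rw [map_smul, hx h hh]

/-- The subgroup of `Γ` fixing every point of the subspace `F`. -/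
def pointwiseStabilizer (Γ : Subgroup O4) (F : Submodule ℝ R4) : Subgroup O4 where
  carrier := {γ | γ ∈ Γ ∧ ∀ x ∈ F, γ x = x}
  mul_mem' := fun {a b} ha hb => ⟨Γ.mul_mem ha.1 hb.1, fun x hx => by
    rw [LinearIsometryEquiv.coe_mul, Function.comp_apply, hb.2 x hx, ha.2 x hx]⟩
  one_mem' := ⟨Γ.one_mem, fun _ _ => rfl⟩
  inv_mem' := fun {a} ha => ⟨Γ.inv_mem ha.1, fun x hx => by
    conv_lhs => rw [← ha.2 x hx]
    exact a.symm_apply_apply x⟩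

/-- The representation of a subgroup of `O(4)` on `ℝ⁴`. -/
def naturalRep (H : Subgroup O4) : Representation ℝ H R4 where
  toFun h := ((h : O4).toLinearEquiv : R4 →ₗ[ℝ] R4)
  map_one' := rfl
  map_mul' _ _ := rfl

/-- The isotypic components of the representation of `H` on `ℝ⁴`, as real subspaces of `ℝ⁴`. -/
def isotypicSubspaces (H : Subgroup O4) : Set (Submodule ℝ R4) :=
  (fun S => (S.restrictScalars ℝ).map (naturalRep H).asModuleEquiv.toLinearMap) ''
    isotypicComponents (MonoidAlgebra ℝ H) (naturalRep H).asModule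

/-- `ℝ⁴ = F 0 ⊕ ⋯ ⊕ F (n-1)` is an orthogonal direct sum, and it is the isotypic decomposition
of the representation of `H`: the `F i` are its isotypic components, without repetition. -/
structure IsIsotypicDecomposition (H : Subgroup O4) {n : ℕ} (F : Fin n → Submodule ℝ R4) :
    Prop where
  injective : Function.Injective F
  range_eq : range F = isotypicSubspaces H
  orthogonal : Pairwise fun i k => F i ⟂ F k
  iSup_eq : ⨆ i, F i = ⊤

/-- The standard action of the dihedral group of order `2m` on the plane: `r i` is the rotation
by `2πi/m`, and `sr i` is that rotation followed by the reflection `(x, y) ↦ (x, -y)`. -/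
def dihedralMatrix (m : ℕ) : DihedralGroup m → Matrix (Fin 2) (Fin 2) ℝ
  | .r i =>
      !![Real.cos (2 * Real.pi * i.val / m), -Real.sin (2 * Real.pi * i.val / m);
         Real.sin (2 * Real.pi * i.val / m), Real.cos (2 * Real.pi * i.val / m)]
  | .sr i =>
      !![Real.cos (2 * Real.pi * i.val / m), -Real.sin (2 * Real.pi * i.val / m);
         -Real.sin (2 * Real.pi * i.val / m), -Real.cos (2 * Real.pi * i.val / m)]

/-- `H` leaves the plane `B` invariant and acts on it as the dihedral group `𝔻ₘ`: in a suitable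
orthonormal basis of `B`, the action of `H` is the standard action of `𝔻ₘ` pulled back along a
surjective homomorphism `H → 𝔻ₘ`. -/
def ActsAsDihedral (H : Subgroup O4) (B : Submodule ℝ R4) (m : ℕ) : Prop :=
  ∃ (b : OrthonormalBasis (Fin 2) ℝ B) (φ : H →* DihedralGroup m), Function.Surjective φ ∧
    ∀ (h : H) (k : Fin 2), (h : O4) (b k : R4) = ∑ i, dihedralMatrix m (φ h) i k • (b i : R4)

/-! ### Dynamics of `ẋ = f(x)` -/

/-- The stable manifold of `p`: the points whose forward trajectory exists for all positive times
and converges to `p`. -/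
def stableManifold (f : R4 → R4) (p : R4) : Set R4 :=
  {x | ∃ u : ℝ → R4, u 0 = x ∧ IsIntegralCurveOn u (fun _ => f) (Ici 0) ∧ Tendsto u atTop (𝓝 p)}

/-- The unstable manifold of `p`: the points whose backward trajectory exists for all negative
times and converges to `p`. -/
def unstableManifold (f : R4 → R4) (p : R4) : Set R4 :=
  {x | ∃ u : ℝ → R4, u 0 = x ∧ IsIntegralCurveOn u (fun _ => f) (Iic 0) ∧ Tendsto u atBot (𝓝 p)}

/-- The complex number `z` is an eigenvalue of `A` with a complex eigenvector `v + i w` in the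
complexification of the subspace `P`. For `P` invariant under `A` this says that `z` is an
eigenvalue of the restriction of `A` to `P`. -/
def HasComplexEigenvalueOn (A : R4 →L[ℝ] R4) (P : Submodule ℝ R4) (z : ℂ) : Prop :=
  ∃ v ∈ P, ∃ w ∈ P, (v ≠ 0 ∨ w ≠ 0) ∧
    A v = z.re • v - z.im • w ∧ A w = z.im • v + z.re • w

/-- `p` is a hyperbolic equilibrium of `f`. -/
def IsHyperbolicEquilibrium (f : R4 → R4) (p : R4) : Prop :=
  f p = 0 ∧ ∀ z, HasComplexEigenvalueOn (fderiv ℝ f p) ⊤ z → z.re ≠ 0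

/-- The equilibrium `p` is a sink for the restriction of `f` to the flow-invariant subspace `P`:
all eigenvalues of `df(p)` on `P` have negative real part. -/
def IsSinkIn (f : R4 → R4) (P : Submodule ℝ R4) (p : R4) : Prop :=
  p ∈ P ∧ f p = 0 ∧ ∀ z, HasComplexEigenvalueOn (fderiv ℝ f p) P z → z.re < 0

/-! ### Heteroclinic cycles; the indices `1, …, M` are taken cyclically, as elements of `ZMod M` -/

/-- The set `κ_j` of trajectories from `ξ_j` to `ξ_{j+1}`. -/
def connection (f : R4 → R4) {M : ℕ} (ξ : ZMod M → R4) (j : ZMod M) : Set R4 :=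
  unstableManifold f (ξ j) ∩ stableManifold f (ξ (j + 1))

/-- The hyperbolic equilibria `ξ_j` and the connections `κ_j ≠ ∅` form a heteroclinic cycle. -/
structure IsHeteroclinicCycle (f : R4 → R4) {M : ℕ} (ξ : ZMod M → R4) : Prop where
  hyperbolic : ∀ j, IsHyperbolicEquilibrium f (ξ j)
  ne : ∀ j, ξ j ≠ ξ (j + 1)
  connected : ∀ j, (connection f ξ j).Nonempty

/-- The point set of the cycle: the union of the equilibria and of the connections. -/
def cycleSet (f : R4 → R4) {M : ℕ} (ξ : ZMod M → R4) : Set R4 :=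
  range ξ ∪ ⋃ j, connection f ξ j

/-- The cycle is robust, with subgroups `Σ_j = Sg j` of `Γ` and `P_j = Fix(Σ_j)`. -/
structure IsRobustCycle (Γ : Subgroup O4) (f : R4 → R4) {M : ℕ} (ξ : ZMod M → R4)
    (Sg : ZMod M → Subgroup O4) : Prop extends IsHeteroclinicCycle f ξ where
  le : ∀ j, Sg j ≤ Γ
  mem : ∀ j, ξ j ∈ fixSpace (Sg j)
  sink : ∀ j, IsSinkIn f (fixSpace (Sg j)) (ξ (j + 1))
  connection_subset : ∀ j, connection f ξ j ⊆ fixSpace (Sg j)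

section Subspaces

variable {M : ℕ} (Γ : Subgroup O4) (Sg : ZMod M → Subgroup O4) (j : ZMod M)

/-- `P_j = Fix(Σ_j)`. -/
def spaceP : Submodule ℝ R4 := fixSpace (Sg j)

/-- `L_j = P_{j-1} ∩ P_j`. -/
def spaceL : Submodule ℝ R4 := spaceP Sg (j - 1) ⊓ spaceP Sg j

/-- `V_j = P_{j-1} ⊖ L_j`, the contracting direction. -/
def spaceV : Submodule ℝ R4 := spaceP Sg (j - 1) ⊓ (spaceL Sg j)ᗮ

/-- `W_j = P_j ⊖ L_j`, the expanding direction. -/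
def spaceW : Submodule ℝ R4 := spaceP Sg j ⊓ (spaceL Sg j)ᗮ

/-- The remaining, transverse direction `T_j`. -/
def spaceT : Submodule ℝ R4 := (spaceL Sg j ⊔ spaceV Sg j ⊔ spaceW Sg j)ᗮ

/-- `Δ_j`, the isotropy subgroup of the axis `L_j`. -/
def groupDelta : Subgroup O4 := pointwiseStabilizer Γ (spaceL Sg j)

theorem fixSpace_groupDelta (h : ∀ i, Sg i ≤ Γ) :
    fixSpace (groupDelta Γ Sg j) = spaceL Sg j := by
  apply le_antisymm
  · intro x hx
    exact ⟨fun s hs => hx s ⟨h _ hs, fun y hy => hy.1 s hs⟩,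
      fun s hs => hx s ⟨h _ hs, fun y hy => hy.2 s hs⟩⟩
  · intro x hx s hs
    exact hs.2 x hx

/-- When `L_j` is a line, `Δ_j` is the isotropy group of each of its nonzero points. -/
theorem mem_groupDelta_iff (hL : Module.finrank ℝ (spaceL Sg j) = 1) {x : R4}
    (hx : x ∈ spaceL Sg j) (hx0 : x ≠ 0) (γ : O4) :
    γ ∈ groupDelta Γ Sg j ↔ γ ∈ Γ ∧ γ x = x := by
  refine ⟨fun h => ⟨h.1, h.2 x hx⟩, fun h => ⟨h.1, fun y hy => ?_⟩⟩
  obtain ⟨c, hc⟩ := (finrank_eq_one_iff_of_nonzero' (⟨x, hx⟩ : spaceL Sg j)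
    (by simpa [Subtype.ext_iff] using hx0)).1 hL ⟨y, hy⟩
  have hc' : c • x = y := congrArg Subtype.val hc
  rw [← hc', map_smul, h.2]

end Subspaces

end

/-! If `P_{j-1} = P_j`, then `L_j` is a plane and `L_j \ {0}` is connected, so by (ii) the cycle has
at most one nonzero point there; but `ξ_j`, `ξ_{j+1}` and a point of `κ_j` are three distinct points
of it. Hence `L`, `V`, `W`, `T` are lines (`IsRobustCycle.isAxisFrame`).

`J` commutes with `Δ`. By averaging, `J` preserves the fixed space of each subgroup of `Δ` and its
orthogonal complement, so the four lines are eigenlines. The sink condition in `P_{j-1}` makes the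
eigenvalues on `L` and `V` negative. If the one on `W` were also negative, `J` would be negative
definite on `P_j` and no connection could leave `ξ_j`; zero is excluded by hyperbolicity
(`IsRobustCycle.eigenvalue_pos`).

So `V` and `W` have eigenvalues `a ≠ e`. An invariant subspace of `Lᗮ` either contains `V` or is
orthogonal to `Fix(S₁)` (`IsAxisFrame.V_le_or_ortho`), and likewise for `W` and `S₂`. Applied to
eigenspaces, this gives `V ⟂ W`. Since `Lᗮ` has dimension 3, `V` or `W` is invariant
(`IsAxisFrame.invariant_V_or_invariant_W`). If both are, type 1 results. If only `V` is, `W ⊔ T` is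
irreducible, hence lies in one eigenspace, and a reflection from `S₂` makes the action dihedral
(`exists_actsAsDihedral`): type 2. Type 3 is its mirror image. -/

noncomputable section

/-! ### Integral curves of `C¹` vector fields -/

section Curves

variable {E : Type*} [NormedAddCommGroup E] [NormedSpace ℝ E] {f : E → E} {u v : ℝ → E}

/-- ODE uniqueness asks for a single Lipschitz constant; a `C¹` field has one on the compact traces
of the two curves. -/
theorem exists_lipschitzOnWith_union_image {a b : ℝ} (hf : ContDiff ℝ 1 f)
    (hu : ContinuousOn u (Icc a b)) (hv : ContinuousOn v (Icc a b)) :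
    ∃ K, LipschitzOnWith K f (u '' Icc a b ∪ v '' Icc a b) :=
  LocallyLipschitzOn.exists_lipschitzOnWith_of_compact
    ((isCompact_Icc.image_of_continuousOn hu).union (isCompact_Icc.image_of_continuousOn hv))
    hf.locallyLipschitz.locallyLipschitzOn

theorem integralCurve_eqOn_of_left_eq {a b : ℝ} (hf : ContDiff ℝ 1 f)
    (hu : IsIntegralCurveOn u (fun _ => f) (Icc a b))
    (hv : IsIntegralCurveOn v (fun _ => f) (Icc a b)) (h : u a = v a) : EqOn u v (Icc a b) := by
  obtain ⟨K, hK⟩ := exists_lipschitzOnWith_union_image hf hu.continuousOn hv.continuousOn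
  refine ODE_solution_unique_of_mem_Icc_right (v := fun _ => f)
    (s := fun _ => u '' Icc a b ∪ v '' Icc a b) (K := K) (fun _ _ => hK) hu.continuousOn
    (fun t ht => ?_) (fun t ht => Or.inl ⟨t, Ico_subset_Icc_self ht, rfl⟩) hv.continuousOn
    (fun t ht => ?_) (fun t ht => Or.inr ⟨t, Ico_subset_Icc_self ht, rfl⟩) h
  · exact (hu t (Ico_subset_Icc_self ht)).mono_of_mem_nhdsWithin (Icc_mem_nhdsGE_of_mem ht)
  · exact (hv t (Ico_subset_Icc_self ht)).mono_of_mem_nhdsWithin (Icc_mem_nhdsGE_of_mem ht)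

theorem integralCurve_eqOn_of_right_eq {a b : ℝ} (hf : ContDiff ℝ 1 f)
    (hu : IsIntegralCurveOn u (fun _ => f) (Icc a b))
    (hv : IsIntegralCurveOn v (fun _ => f) (Icc a b)) (h : u b = v b) : EqOn u v (Icc a b) := by
  obtain ⟨K, hK⟩ := exists_lipschitzOnWith_union_image hf hu.continuousOn hv.continuousOn
  refine ODE_solution_unique_of_mem_Icc_left (v := fun _ => f)
    (s := fun _ => u '' Icc a b ∪ v '' Icc a b) (K := K) (fun _ _ => hK) hu.continuousOn
    (fun t ht => ?_) (fun t ht => Or.inl ⟨t, Ioc_subset_Icc_self ht, rfl⟩) hv.continuousOn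
    (fun t ht => ?_) (fun t ht => Or.inr ⟨t, Ioc_subset_Icc_self ht, rfl⟩) h
  · exact (hu t (Ioc_subset_Icc_self ht)).mono_of_mem_nhdsWithin (Icc_mem_nhdsLE_of_mem ht)
  · exact (hv t (Ioc_subset_Icc_self ht)).mono_of_mem_nhdsWithin (Icc_mem_nhdsLE_of_mem ht)

theorem isIntegralCurveOn_const {p : E} (hp : f p = 0) (s : Set ℝ) :
    IsIntegralCurveOn (fun _ => p) (fun _ => f) s := fun t _ => by
  simpa [hp] using hasDerivWithinAt_const t s p

/-- A forward trajectory starting at an equilibrium can only converge to that equilibrium. -/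
theorem eq_of_tendsto_atTop_of_equilibrium {p q : E} (hf : ContDiff ℝ 1 f) (hp : f p = 0)
    (hu : IsIntegralCurveOn u (fun _ => f) (Ici 0)) (h0 : u 0 = p) (hq : Tendsto u atTop (𝓝 q)) :
    p = q := by
  refine tendsto_nhds_unique (tendsto_const_nhds.congr' ?_) hq
  filter_upwards [eventually_ge_atTop 0] with t ht
  exact (integralCurve_eqOn_of_left_eq hf (hu.mono Icc_subset_Ici_self)
    (isIntegralCurveOn_const hp _) h0 (right_mem_Icc.2 ht)).symm

/-- A backward trajectory starting at an equilibrium can only converge to that equilibrium. -/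
theorem eq_of_tendsto_atBot_of_equilibrium {p q : E} (hf : ContDiff ℝ 1 f) (hp : f p = 0)
    (hu : IsIntegralCurveOn u (fun _ => f) (Iic 0)) (h0 : u 0 = p) (hq : Tendsto u atBot (𝓝 q)) :
    p = q := by
  refine tendsto_nhds_unique (tendsto_const_nhds.congr' ?_) hq
  filter_upwards [eventually_le_atBot 0] with t ht
  exact (integralCurve_eqOn_of_right_eq hf (hu.mono Icc_subset_Iic_self)
    (isIntegralCurveOn_const hp _) h0 (left_mem_Icc.2 ht)).symm

end Curves

/-- If the linearization at the equilibrium `p` is negative definite on the subspace `P`, the only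
trajectory in `P` that converges to `p` in backward time is `p` itself. -/
theorem eq_of_tendsto_atBot_of_negDef {E : Type*} [NormedAddCommGroup E] [InnerProductSpace ℝ E]
    {f : E → E} {u : ℝ → E} {P : Submodule ℝ E} {p : E} {α : ℝ} (hf : ContDiff ℝ 1 f)
    (hp : f p = 0) (hpP : p ∈ P) (hα : 0 < α)
    (hneg : ∀ h ∈ P, inner ℝ (fderiv ℝ f p h) h ≤ -α * ‖h‖ ^ 2)
    (hu : IsIntegralCurveOn u (fun _ => f) (Iic 0)) (huP : ∀ t ≤ 0, u t ∈ P)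
    (hlim : Tendsto u atBot (𝓝 p)) : u 0 = p := by
  have hd : HasFDerivAt f (fderiv ℝ f p) p := (hf.differentiable one_ne_zero p).hasFDerivAt
  -- The bound on the first-order remainder is chosen as exactly `α`, so that the definiteness of
  -- the linearization absorbs it and `‖u - p‖ ^ 2` is nonincreasing near `-∞`.
  have hev := hlim.eventually (hd.isLittleO.bound hα)
  obtain ⟨t₀, ht₀⟩ := eventually_atBot.1 hev
  set s := min t₀ 0
  have hs0 : s ≤ 0 := min_le_right _ _
  have hder : ∀ t < s, HasDerivAt (fun t => ‖u t - p‖ ^ 2) (2 * inner ℝ (u t - p) (f (u t))) t := by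
    intro t ht
    have h1 : HasDerivAt u (f (u t)) t :=
      (hu t (ht.le.trans hs0)).hasDerivAt (Iic_mem_nhds (ht.trans_le hs0))
    exact (h1.sub_const p).norm_sq
  have hle : ∀ t < s, 2 * inner ℝ (u t - p) (f (u t)) ≤ 0 := by
    intro t ht
    have hb := ht₀ t (ht.le.trans (min_le_left _ _))
    rw [hp, sub_zero] at hb
    have hm := hneg (u t - p) (P.sub_mem (huP t (ht.le.trans hs0)) hpP)
    have hc := real_inner_le_norm (u t - p) (f (u t) - fderiv ℝ f p (u t - p))
    rw [inner_sub_right, real_inner_comm (fderiv ℝ f p (u t - p))] at hc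
    have := mul_le_mul_of_nonneg_left hb (norm_nonneg (u t - p))
    nlinarith
  have hcont : ContinuousOn (fun t => ‖u t - p‖ ^ 2) (Iic s) :=
    (((hu.continuousOn.mono (Iic_subset_Iic.2 hs0)).sub continuousOn_const).norm).pow 2
  have hanti : AntitoneOn (fun t => ‖u t - p‖ ^ 2) (Iic s) := by
    refine antitoneOn_of_deriv_nonpos (convex_Iic s) hcont ?_ ?_
    · intro t ht
      rw [interior_Iic] at ht
      exact (hder t ht).differentiableAt.differentiableWithinAt
    · intro t ht
      rw [interior_Iic] at ht
      rw [(hder t ht).deriv]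
      exact hle t ht
  have hlim2 : Tendsto (fun t => ‖u t - p‖ ^ 2) atBot (𝓝 0) := by
    have := ((hlim.sub_const p).norm).pow 2
    simpa using this
  -- A nonincreasing function stays below its limit at `-∞`, which is `0`.
  have hz : ‖u s - p‖ ^ 2 ≤ 0 := by
    refine ge_of_tendsto hlim2 ?_
    filter_upwards [eventually_le_atBot s] with t ht
    exact hanti ht (mem_Iic.2 le_rfl) ht
  have hus : u s = p := by
    have : ‖u s - p‖ = 0 := by nlinarith [norm_nonneg (u s - p)]
    exact sub_eq_zero.1 (norm_eq_zero.1 this)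
  exact integralCurve_eqOn_of_left_eq hf (hu.mono Icc_subset_Iic_self)
    (isIntegralCurveOn_const hp _) hus (right_mem_Icc.2 hs0)

/-- Fixed-point subspaces of symmetries are invariant under the flow in backward time. -/
theorem integralCurve_mem_fixSpace {f : R4 → R4} {u : ℝ → R4} {H : Subgroup O4}
    (hf : ContDiff ℝ 1 f) (hH : IsEquivariant H f)
    (hu : IsIntegralCurveOn u (fun _ => f) (Iic 0)) (h0 : u 0 ∈ fixSpace H) {t : ℝ} (ht : t ≤ 0) :
    u t ∈ fixSpace H := by
  intro γ hγ
  have hγu : IsIntegralCurveOn (fun t => γ (u t)) (fun _ => f) (Iic 0) := by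
    intro t ht
    have := (γ.toContinuousLinearEquiv.toContinuousLinearMap.hasFDerivAt).comp_hasDerivWithinAt t
      (hu t ht)
    simp only [hH γ hγ]
    exact this
  exact integralCurve_eqOn_of_right_eq hf (hγu.mono Icc_subset_Iic_self)
    (hu.mono Icc_subset_Iic_self) (h0 γ hγ) (left_mem_Icc.2 ht)

/-! ### Averaging over a finite group -/

/-- `E` is mapped into itself by every element of `H`. -/
def IsInvariantUnder (H : Subgroup O4) (E : Submodule ℝ R4) : Prop :=
  ∀ h ∈ H, ∀ x ∈ E, h x ∈ E

/-- Every element of `H` commutes with `J`. -/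
def CommutesWith (H : Subgroup O4) (J : Module.End ℝ R4) : Prop :=
  ∀ h ∈ H, ∀ x, J (h x) = h (J x)

section Averaging

variable {H : Subgroup O4}

theorem IsInvariantUnder.mono {K : Subgroup O4} {E : Submodule ℝ R4} (hE : IsInvariantUnder K E)
    (h : H ≤ K) : IsInvariantUnder H E := fun γ hγ => hE γ (h hγ)

theorem IsInvariantUnder.inf {E F : Submodule ℝ R4} (hE : IsInvariantUnder H E)
    (hF : IsInvariantUnder H F) : IsInvariantUnder H (E ⊓ F) :=
  fun γ hγ x hx => ⟨hE γ hγ x hx.1, hF γ hγ x hx.2⟩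

theorem IsInvariantUnder.sup {E F : Submodule ℝ R4} (hE : IsInvariantUnder H E)
    (hF : IsInvariantUnder H F) : IsInvariantUnder H (E ⊔ F) := by
  intro γ hγ x hx
  obtain ⟨y, hy, z, hz, rfl⟩ := Submodule.mem_sup.1 hx
  rw [map_add]
  exact Submodule.add_mem_sup (hE γ hγ y hy) (hF γ hγ z hz)

theorem IsInvariantUnder.orthogonal {E : Submodule ℝ R4} (hE : IsInvariantUnder H E) :
    IsInvariantUnder H Eᗮ := by
  intro γ hγ x hx y hy
  have h := hx (γ⁻¹ y) (hE γ⁻¹ (H.inv_mem hγ) y hy)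
  rw [← γ.inner_map_map] at h
  rwa [show γ (γ⁻¹ y) = y from γ.apply_symm_apply y] at h

theorem isInvariantUnder_fixSpace : IsInvariantUnder H (fixSpace H) := fun γ hγ x hx => by
  rwa [hx γ hγ]

theorem isInvariantUnder_eigenspace {J : Module.End ℝ R4} (hJ : CommutesWith H J) (a : ℝ) :
    IsInvariantUnder H (J.eigenspace a) := by
  intro γ hγ x hx
  rw [Module.End.mem_eigenspace_iff] at hx ⊢
  rw [hJ γ hγ, hx, map_smul]

theorem map_mem_fixSpace {J : Module.End ℝ R4} (hJ : CommutesWith H J) {x : R4}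
    (hx : x ∈ fixSpace H) : J x ∈ fixSpace H := fun γ hγ => by
  rw [← hJ γ hγ, hx γ hγ]

/-- The (unnormalized) average of `x` over `H`. -/
def groupSum (H : Subgroup O4) [Fintype H] (x : R4) : R4 := ∑ h : H, (h : O4) x

variable [Fintype H]

theorem groupSum_mem_fixSpace (x : R4) : groupSum H x ∈ fixSpace H := by
  intro γ hγ
  rw [groupSum, map_sum]
  exact Fintype.sum_equiv (Equiv.mulLeft (⟨γ, hγ⟩ : H)) _ _ fun _ => rfl

theorem groupSum_mem {E : Submodule ℝ R4} (hE : IsInvariantUnder H E) {x : R4} (hx : x ∈ E) :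
    groupSum H x ∈ E :=
  E.sum_mem fun h _ => hE h h.2 x hx

theorem inner_groupSum {y : R4} (hy : y ∈ fixSpace H) (x : R4) :
    inner ℝ (groupSum H x) y = (Fintype.card H : ℝ) * inner ℝ x y := by
  have (h : H) : inner ℝ ((h : O4) x) y = inner ℝ x y := by
    conv_lhs => rw [← hy h h.2]
    exact (h : O4).inner_map_map x y
  simp [groupSum, sum_inner, this]

theorem map_groupSum {J : Module.End ℝ R4} (hJ : CommutesWith H J) (x : R4) :
    J (groupSum H x) = groupSum H (J x) := by
  simp only [groupSum, map_sum]
  exact Finset.sum_congr rfl fun h _ => hJ h h.2 x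

/-- With `inner_eq_zero_of_groupSum_eq_zero` this identifies `(fixSpace H)ᗮ` with the kernel of the
averaging map. Any `J` commuting with `H` preserves that kernel, self-adjoint or not. -/
theorem groupSum_eq_zero {x : R4} (hx : x ∈ (fixSpace H)ᗮ) : groupSum H x = 0 := by
  have h := inner_groupSum (groupSum_mem_fixSpace (H := H) x) x
  rw [real_inner_comm _ x, hx _ (groupSum_mem_fixSpace x), mul_zero] at h
  exact inner_self_eq_zero.1 h

end Averaging

theorem inner_eq_zero_of_groupSum_eq_zero {H : Subgroup O4} [Fintype H] {x y : R4}
    (hx : groupSum H x = 0) (hy : y ∈ fixSpace H) : inner ℝ x y = 0 := by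
  have h := inner_groupSum hy x
  rw [hx, inner_zero_left] at h
  exact (mul_eq_zero.1 h.symm).resolve_left (by exact_mod_cast Fintype.card_ne_zero)

/-- An invariant subspace without nonzero fixed vectors is orthogonal to the fixed vectors. -/
theorem isOrtho_fixSpace {H : Subgroup O4} [Finite H] {E : Submodule ℝ R4}
    (hE : IsInvariantUnder H E) (h : E ⊓ fixSpace H = ⊥) : E ⟂ fixSpace H := by
  have := Fintype.ofFinite H
  rw [Submodule.isOrtho_iff_inner_eq]
  intro x hx y hy
  refine inner_eq_zero_of_groupSum_eq_zero ?_ hy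
  exact (Submodule.mem_bot ℝ).1 (h ▸ ⟨groupSum_mem hE hx, groupSum_mem_fixSpace x⟩)

/-- Commuting maps preserve the orthogonal complement of the fixed vectors. -/
theorem map_mem_fixSpace_orthogonal {H : Subgroup O4} [Finite H] {J : Module.End ℝ R4}
    (hJ : CommutesWith H J) {x : R4} (hx : x ∈ (fixSpace H)ᗮ) : J x ∈ (fixSpace H)ᗮ := by
  have := Fintype.ofFinite H
  intro y hy
  rw [real_inner_comm]
  refine inner_eq_zero_of_groupSum_eq_zero ?_ hy
  rw [← map_groupSum hJ, groupSum_eq_zero hx, map_zero]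

/-- The derivative of an equivariant map at a fixed point of `H` commutes with `H`. -/
theorem commutesWith_fderiv {H : Subgroup O4} {f : R4 → R4} (hf : Differentiable ℝ f)
    (hH : IsEquivariant H f) {p : R4} (hp : p ∈ fixSpace H) :
    CommutesWith H (fderiv ℝ f p).toLinearMap := by
  intro γ hγ x
  let g : R4 →L[ℝ] R4 := γ.toContinuousLinearEquiv.toContinuousLinearMap
  have hgp : g p = p := hp γ hγ
  have h1 : HasFDerivAt (fun y => f (g y)) ((fderiv ℝ f p).comp g) p := by
    refine HasFDerivAt.comp p ?_ g.hasFDerivAt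
    rw [hgp]
    exact (hf p).hasFDerivAt
  have h2 : HasFDerivAt (fun y => g (f y)) (g.comp (fderiv ℝ f p)) p :=
    g.hasFDerivAt.comp p (hf p).hasFDerivAt
  have h3 : (fun y => f (g y)) = fun y => g (f y) := funext fun y => hH γ hγ y
  rw [h3] at h1
  exact congrArg (fun A : R4 →L[ℝ] R4 => A x) (h1.unique h2)

/-! ### Finite groups of isometries of the plane -/

/-- The matrix of multiplication by the complex number `z`. -/
def rotationMatrix (z : ℂ) : Matrix (Fin 2) (Fin 2) ℝ := !![z.re, -z.im; z.im, z.re]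

/-- The matrix of complex conjugation. -/
def flipMatrix : Matrix (Fin 2) (Fin 2) ℝ := !![1, 0; 0, -1]

theorem rotationMatrix_injective : Function.Injective rotationMatrix := by
  intro z w h
  have h0 := congrFun (congrFun h 0) 0
  have h1 := congrFun (congrFun h 1) 0
  exact Complex.ext h0 h1

theorem rotationMatrix_mul (z w : ℂ) :
    rotationMatrix (z * w) = rotationMatrix z * rotationMatrix w := by
  ext i j
  fin_cases i <;> fin_cases j <;> simp [rotationMatrix, Matrix.mul_apply] <;> ring

theorem rotationMatrix_one : rotationMatrix 1 = 1 := by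
  ext i j
  fin_cases i <;> fin_cases j <;> simp [rotationMatrix]

theorem flipMatrix_mul_self : flipMatrix * flipMatrix = 1 := by
  ext i j
  fin_cases i <;> fin_cases j <;> simp [flipMatrix, Matrix.mul_apply]

theorem rotationMatrix_mul_flipMatrix (z : Circle) :
    rotationMatrix z * flipMatrix = flipMatrix * rotationMatrix (z⁻¹ : Circle) := by
  rw [Circle.coe_inv_eq_conj]
  ext i j
  fin_cases i <;> fin_cases j <;> simp [rotationMatrix, flipMatrix, Matrix.mul_apply]

theorem rotationMatrix_ne_flipMatrix_mul (z w : Circle) :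
    rotationMatrix z ≠ flipMatrix * rotationMatrix w := by
  intro h
  have hz : Matrix.det (rotationMatrix z) = 1 := by
    have := Circle.normSq_coe z
    rw [Complex.normSq_apply] at this
    simp [rotationMatrix, Matrix.det_fin_two, ← this]
  have hw : Matrix.det (flipMatrix * rotationMatrix w) = -1 := by
    have := Circle.normSq_coe w
    rw [Complex.normSq_apply] at this
    rw [Matrix.det_mul]
    simp [rotationMatrix, flipMatrix, Matrix.det_fin_two, this]
  rw [h, hw] at hz
  norm_num at hz

/-- An orthogonal matrix of size two is a rotation or a rotation followed by a reflection. -/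
theorem eq_rotationMatrix_or_eq_flipMatrix_mul {A : Matrix (Fin 2) (Fin 2) ℝ}
    (hA : A.transpose * A = 1) :
    ∃ z : Circle, A = rotationMatrix z ∨ A = flipMatrix * rotationMatrix z := by
  have h00 : A 0 0 * A 0 0 + A 1 0 * A 1 0 = 1 := by
    simpa [Matrix.mul_apply] using congrFun (congrFun hA 0) 0
  have h01 : A 0 0 * A 0 1 + A 1 0 * A 1 1 = 0 := by
    simpa [Matrix.mul_apply] using congrFun (congrFun hA 0) 1
  have h11 : A 0 1 * A 0 1 + A 1 1 * A 1 1 = 1 := by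
    simpa [Matrix.mul_apply] using congrFun (congrFun hA 1) 1
  -- `d` is the determinant. Lagrange's identity gives `d * d = 1`, and the second column is `d`
  -- times the first one turned by a right angle.
  set d := A 0 0 * A 1 1 - A 1 0 * A 0 1 with hd
  have hdd : d * d = 1 := by
    have : d * d = (A 0 0 * A 0 0 + A 1 0 * A 1 0) * (A 0 1 * A 0 1 + A 1 1 * A 1 1)
      - (A 0 0 * A 0 1 + A 1 0 * A 1 1) ^ 2 := by rw [hd]; ring
    rw [this, h00, h01, h11]; norm_num
  have hb : A 0 1 = -(d * A 1 0) := by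
    linear_combination (-A 0 1) * h00 + A 0 0 * h01 + A 1 0 * hd
  have hc : A 1 1 = d * A 0 0 := by
    linear_combination (-A 1 1) * h00 + A 1 0 * h01 - A 0 0 * hd
  -- To be used with `s = d`: the first column, reflected when `d = -1`, is the point `z` of the
  -- circle.
  have key (s : ℝ) (hs : s * s = 1) : ∃ z : Circle, (z : ℂ) = ⟨A 0 0, s * A 1 0⟩ := by
    refine ⟨⟨_, mem_sphere_zero_iff_norm.2 ?_⟩, rfl⟩
    rw [Complex.norm_def, Complex.normSq_mk, Real.sqrt_eq_one]
    linear_combination h00 + A 1 0 * A 1 0 * hs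
  rcases mul_self_eq_one_iff.1 hdd with h | h
  · obtain ⟨z, hz⟩ := key 1 (by norm_num)
    refine ⟨z, Or.inl ?_⟩
    rw [h] at hb hc
    ext i j
    fin_cases i <;> fin_cases j <;> simp [rotationMatrix, hz, hb, hc]
  · obtain ⟨z, hz⟩ := key (-1) (by norm_num)
    refine ⟨z, Or.inr ?_⟩
    rw [h] at hb hc
    ext i j
    fin_cases i <;> fin_cases j <;> simp [rotationMatrix, flipMatrix, Matrix.mul_apply, hz, hb, hc]

section Dihedral

variable {m : ℕ} [NeZero m]

theorem dihedralMatrix_r (i : ZMod m) :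
    dihedralMatrix m (.r i) = rotationMatrix (ZMod.toCircle i) := by
  have h : ((ZMod.toCircle i : Circle) : ℂ)
      = Complex.exp (((2 * Real.pi * i.val / m : ℝ) : ℂ) * Complex.I) := by
    rw [ZMod.toCircle_apply]
    push_cast
    congr 1
    ring
  rw [h, rotationMatrix, Complex.exp_ofReal_mul_I_re, Complex.exp_ofReal_mul_I_im, dihedralMatrix]

theorem dihedralMatrix_sr (i : ZMod m) :
    dihedralMatrix m (.sr i) = flipMatrix * dihedralMatrix m (.r i) := by
  ext k l
  fin_cases k <;> fin_cases l <;> simp [dihedralMatrix, flipMatrix, Matrix.mul_apply]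

theorem dihedralMatrix_injective : Function.Injective (dihedralMatrix m) := by
  have hr {i j : ZMod m} (h : rotationMatrix (ZMod.toCircle i) = rotationMatrix (ZMod.toCircle j)) :
      i = j := ZMod.injective_toCircle (Circle.coe_injective (rotationMatrix_injective h))
  rintro (i | i) (j | j) h <;> simp only [dihedralMatrix_sr, dihedralMatrix_r] at h
  · rw [hr h]
  · exact absurd h (rotationMatrix_ne_flipMatrix_mul _ _)
  · exact absurd h.symm (rotationMatrix_ne_flipMatrix_mul _ _)
  · have h' := congrArg (flipMatrix * ·) h
    simp only [← mul_assoc, flipMatrix_mul_self, one_mul] at h'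
    rw [hr h']

/-- Moving the flip past a rotation inverts the rotation, which is the rule `r i * sr j = sr (j -
i)` of `DihedralGroup`. -/
theorem dihedralMatrix_mul (g h : DihedralGroup m) :
    dihedralMatrix m (g * h) = dihedralMatrix m g * dihedralMatrix m h := by
  have hsub (i j : ZMod m) : (ZMod.toCircle (j - i) : Circle)
      = (ZMod.toCircle i)⁻¹ * ZMod.toCircle j := by
    rw [sub_eq_neg_add, AddChar.map_add_eq_mul, AddChar.map_neg_eq_inv]
  rcases g with i | i <;> rcases h with j | j
  · rw [DihedralGroup.r_mul_r]
    simp only [dihedralMatrix_r, AddChar.map_add_eq_mul, Circle.coe_mul, rotationMatrix_mul]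
  · rw [DihedralGroup.r_mul_sr]
    simp only [dihedralMatrix_sr, dihedralMatrix_r, hsub, Circle.coe_mul, rotationMatrix_mul]
    rw [← mul_assoc, ← mul_assoc, rotationMatrix_mul_flipMatrix]
  · rw [DihedralGroup.sr_mul_r]
    simp only [dihedralMatrix_sr, dihedralMatrix_r, AddChar.map_add_eq_mul, Circle.coe_mul,
      rotationMatrix_mul, mul_assoc]
  · rw [DihedralGroup.sr_mul_sr]
    simp only [dihedralMatrix_sr, dihedralMatrix_r, hsub, Circle.coe_mul, rotationMatrix_mul]
    rw [mul_assoc flipMatrix, ← mul_assoc _ flipMatrix, rotationMatrix_mul_flipMatrix, mul_assoc,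
      ← mul_assoc flipMatrix flipMatrix, flipMatrix_mul_self, one_mul]

theorem exists_toCircle_eq_of_pow_eq_one {z : Circle} (hz : z ^ m = 1) :
    ∃ i : ZMod m, ZMod.toCircle i = z := by
  have hz' : (Circle.toUnits z) ∈ rootsOfUnity m ℂ := by
    rw [mem_rootsOfUnity, ← map_pow, hz, map_one]
  obtain ⟨i, -, hi⟩ := (Complex.mem_rootsOfUnity m _).1 hz'
  refine ⟨(i : ZMod m), Circle.ext ?_⟩
  have := ZMod.toCircle_intCast (N := m) (i : ℤ)
  push_cast at this
  rw [this]
  simp only [Circle.toUnits_apply, Units.val_mk0] at hi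
  rw [← hi]
  congr 1
  ring

end Dihedral

/-- A finite group of isometries of the plane that contains the reflection in an axis, but does not
leave that axis invariant, is a dihedral group `𝔻ₘ` with `m ≥ 3`. -/
theorem exists_dihedral_of_orthogonal_rep {G : Type*} [Group G] [Finite G]
    (ρ : G →* Matrix (Fin 2) (Fin 2) ℝ) (hρ : ∀ g, (ρ g).transpose * ρ g = 1)
    (hflip : ∃ s, ρ s = flipMatrix) (hirr : ∃ g, ρ g 1 0 ≠ 0) :
    ∃ m, 3 ≤ m ∧ ∃ φ : G →* DihedralGroup m, Function.Surjective φ ∧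
      ∀ g, ρ g = dihedralMatrix m (φ g) := by
  obtain ⟨s, hs⟩ := hflip
  -- The rotations that occur in the image of `ρ`; their number will be `m`.
  let C : Subgroup Circle :=
    { carrier := {z | ∃ g, ρ g = rotationMatrix z}
      one_mem' := ⟨1, by rw [map_one, Circle.coe_one, rotationMatrix_one]⟩
      mul_mem' := by
        rintro z w ⟨g, hg⟩ ⟨h, hh⟩
        exact ⟨g * h, by rw [map_mul, hg, hh, Circle.coe_mul, rotationMatrix_mul]⟩
      inv_mem' := by
        rintro z ⟨g, hg⟩
        refine ⟨g⁻¹, ?_⟩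
        have h1 : ρ g⁻¹ * ρ g = 1 := by rw [← map_mul, inv_mul_cancel, map_one]
        have h2 : ρ g * rotationMatrix (z⁻¹ : Circle) = 1 := by
          rw [hg, ← rotationMatrix_mul, ← Circle.coe_mul, mul_inv_cancel, Circle.coe_one,
            rotationMatrix_one]
        exact left_inv_eq_right_inv h1 h2 }
  have hC (z : Circle) : z ∈ C ↔ ∃ g, ρ g = rotationMatrix z := Iff.rfl
  have hfin : Finite C := by
    choose g hg using fun z : C => z.2
    refine Finite.of_injective g fun z w h => ?_
    have := (hg z).symm.trans ((congrArg ρ h).trans (hg w))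
    exact Subtype.ext (Circle.coe_injective (rotationMatrix_injective this))
  set m := Nat.card C with hm
  have : NeZero m := ⟨Nat.card_pos.ne'⟩
  have hpow {z : Circle} (hz : z ∈ C) : z ^ m = 1 :=
    congrArg Subtype.val (pow_card_eq_one' (x := (⟨z, hz⟩ : C)))
  -- By Lagrange, `C` consists of `m`-th roots of unity; it has `m` elements, so it contains all of
  -- them.
  have hrange : (C : Set Circle) = range (ZMod.toCircle (N := m)) := by
    refine Set.eq_of_subset_of_ncard_le
      (fun z hz => exists_toCircle_eq_of_pow_eq_one (hpow hz)) ?_ (finite_range _)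
    rw [← image_univ, ncard_image_of_injective _ ZMod.injective_toCircle, ncard_univ, Nat.card_zmod]
    exact hm.le
  have hmem (i : ZMod m) : ZMod.toCircle i ∈ C :=
    (hrange.symm ▸ mem_range_self i : ZMod.toCircle i ∈ (C : Set Circle))
  have hex (g : G) : ∃ d : DihedralGroup m, ρ g = dihedralMatrix m d := by
    obtain ⟨z, hz | hz⟩ := eq_rotationMatrix_or_eq_flipMatrix_mul (hρ g)
    · obtain ⟨i, hi⟩ := exists_toCircle_eq_of_pow_eq_one (hpow ((hC z).2 ⟨g, hz⟩))
      exact ⟨.r i, by rw [dihedralMatrix_r, hi, hz]⟩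
    -- Composing with the given reflection `s` turns a reflection into a rotation.
    · have hz' : ρ (s * g) = rotationMatrix z := by
        rw [map_mul, hs, hz, ← mul_assoc, flipMatrix_mul_self, one_mul]
      obtain ⟨i, hi⟩ := exists_toCircle_eq_of_pow_eq_one (hpow ((hC z).2 ⟨_, hz'⟩))
      exact ⟨.sr i, by rw [dihedralMatrix_sr, dihedralMatrix_r, hi, hz]⟩
  choose φ hφ using hex
  refine ⟨m, ?_, MonoidHom.mk' φ fun g h => dihedralMatrix_injective ?_, ?_, hφ⟩
  -- For `m ≤ 2` the only rotations are `±1`, so every matrix `ρ g` would be diagonal.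
  · by_contra! hlt
    obtain ⟨g, hg⟩ := hirr
    have him (i : ZMod m) : (ZMod.toCircle i : ℂ).im = 0 := by
      have h1 : ((ZMod.toCircle i : Circle) : ℂ) ^ m = 1 := by
        rw [← Circle.coe_pow, hpow (hmem i), Circle.coe_one]
      have hm12 : m = 1 ∨ m = 2 := by have := NeZero.pos m; omega
      generalize ((ZMod.toCircle i : Circle) : ℂ) = z at h1 ⊢
      rcases hm12 with h | h
      · rw [h, pow_one] at h1
        simp [h1]
      · rw [h] at h1
        rcases mul_self_eq_one_iff.1 (sq z ▸ h1) with h1 | h1 <;> simp [h1]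
    rw [hφ] at hg
    rcases hd : φ g with i | i <;> rw [hd] at hg
    · exact hg (by simpa [dihedralMatrix_r, rotationMatrix] using him i)
    · exact hg (by simpa [dihedralMatrix_sr, dihedralMatrix_r, rotationMatrix, flipMatrix,
        Matrix.mul_apply] using him i)
  · rw [dihedralMatrix_mul, ← hφ, ← hφ, ← hφ, map_mul]
  · rintro (i | i)
    · obtain ⟨g, hg⟩ := (hC _).1 (hmem i)
      exact ⟨g, dihedralMatrix_injective (by rw [MonoidHom.mk'_apply, ← hφ, hg, dihedralMatrix_r])⟩
    · obtain ⟨g, hg⟩ := (hC _).1 (hmem i)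
      exact ⟨s * g, dihedralMatrix_injective (by
        rw [MonoidHom.mk'_apply, ← hφ, map_mul, hs, hg, dihedralMatrix_sr, dihedralMatrix_r])⟩

/-! ### Matrices of the action on an invariant plane. -/

section PlaneRep

variable {Δ : Subgroup O4} {B : Submodule ℝ R4}

theorem eq_sum_inner_smul (b : OrthonormalBasis (Fin 2) ℝ B) {z : R4} (hz : z ∈ B) :
    z = ∑ i, inner ℝ (b i : R4) z • (b i : R4) := by
  have h := congrArg Subtype.val (b.sum_repr' (⟨z, hz⟩ : B))
  simpa using h.symm

theorem inner_basis_eq_ite (b : OrthonormalBasis (Fin 2) ℝ B) (i k : Fin 2) :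
    inner ℝ (b i : R4) (b k : R4) = if i = k then (1 : ℝ) else 0 :=
  orthonormal_iff_ite.1 b.orthonormal i k

/-- The matrices of the action of `Δ` on an invariant plane, in an orthonormal basis. -/
def planeRep (hB : IsInvariantUnder Δ B) (b : OrthonormalBasis (Fin 2) ℝ B) :
    Δ →* Matrix (Fin 2) (Fin 2) ℝ where
  toFun h := Matrix.of fun i k => inner ℝ (b i : R4) ((h : O4) (b k : R4))
  map_one' := by
    ext i k
    exact inner_basis_eq_ite b i k
  map_mul' g h := by
    ext i k
    have h1 : ((g * h : Δ) : O4) (b k : R4) = (g : O4) ((h : O4) (b k : R4)) := rfl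
    rw [Matrix.mul_apply, Matrix.of_apply, h1, eq_sum_inner_smul b (hB h h.2 _ (b k).2)]
    simp only [map_sum, map_smul, inner_sum, inner_smul_right, Matrix.of_apply]
    exact Finset.sum_congr rfl fun l _ => mul_comm _ _

variable (hB : IsInvariantUnder Δ B) (b : OrthonormalBasis (Fin 2) ℝ B)

theorem planeRep_apply (h : Δ) (i k : Fin 2) :
    planeRep hB b h i k = inner ℝ (b i : R4) ((h : O4) (b k : R4)) := rfl

theorem apply_basis_eq_sum (h : Δ) (k : Fin 2) :
    (h : O4) (b k : R4) = ∑ i, planeRep hB b h i k • (b i : R4) :=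
  eq_sum_inner_smul b (hB h h.2 _ (b k).2)

theorem planeRep_transpose_mul_self (h : Δ) :
    (planeRep hB b h).transpose * planeRep hB b h = 1 := by
  ext i k
  rw [Matrix.one_apply, ← inner_basis_eq_ite b, ← (h : O4).inner_map_map,
    apply_basis_eq_sum hB b h i, apply_basis_eq_sum hB b h k, Matrix.mul_apply, sum_inner]
  refine Finset.sum_congr rfl fun l _ => ?_
  simp only [inner_sum, real_inner_smul_left, real_inner_smul_right, inner_basis_eq_ite,
    Matrix.transpose_apply, mul_ite, mul_one, mul_zero, Finset.sum_ite_eq, Finset.mem_univ, if_true]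
  exact mul_comm _ _

end PlaneRep

theorem exists_unit_generator {Z : Submodule ℝ R4} (hZ : Module.finrank ℝ Z = 1) :
    ∃ z ∈ Z, ‖z‖ = 1 ∧ ∀ w ∈ Z, ∃ a : ℝ, w = a • z := by
  obtain ⟨z, hz, hz0⟩ := Z.exists_mem_ne_zero_of_ne_bot (by
    rintro rfl
    simp at hZ)
  have hn : ‖z‖ ≠ 0 := norm_ne_zero_iff.2 hz0
  refine ⟨‖z‖⁻¹ • z, Z.smul_mem _ hz, by simp [norm_smul, hn], fun w hw => ?_⟩
  obtain ⟨c, hc⟩ := (finrank_eq_one_iff_of_nonzero' (⟨z, hz⟩ : Z)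
    (by simpa [Subtype.ext_iff] using hz0)).1 hZ ⟨w, hw⟩
  refine ⟨c * ‖z‖, ?_⟩
  rw [mul_smul, smul_inv_smul₀ hn]
  exact (congrArg Subtype.val hc).symm

theorem exists_orthonormalBasis_sup {X Y : Submodule ℝ R4} (hXY : X ⟂ Y) {x y : R4} (hx : x ∈ X)
    (hy : y ∈ Y) (hx1 : ‖x‖ = 1) (hy1 : ‖y‖ = 1) (hxs : ∀ w ∈ X, ∃ a : ℝ, w = a • x)
    (hys : ∀ w ∈ Y, ∃ a : ℝ, w = a • y) :
    ∃ b : OrthonormalBasis (Fin 2) ℝ ↥(X ⊔ Y), (b 0 : R4) = x ∧ (b 1 : R4) = y := by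
  have hxy : inner ℝ x y = 0 := Submodule.isOrtho_iff_inner_eq.1 hXY x hx y hy
  have hyx : inner ℝ y x = 0 := by rw [real_inner_comm, hxy]
  let e : Fin 2 → ↥(X ⊔ Y) :=
    ![⟨x, Submodule.mem_sup_left hx⟩, ⟨y, Submodule.mem_sup_right hy⟩]
  have he : Orthonormal ℝ e := by
    constructor
    · intro i
      fin_cases i
      exacts [hx1, hy1]
    · intro i k hik
      fin_cases i <;> fin_cases k
      exacts [absurd rfl hik, hxy, hyx, absurd rfl hik]
  have hspan : ⊤ ≤ Submodule.span ℝ (range e) := by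
    rintro ⟨z, hz⟩ -
    obtain ⟨p, hp, q, hq, rfl⟩ := Submodule.mem_sup.1 hz
    obtain ⟨a, rfl⟩ := hxs p hp
    obtain ⟨c, rfl⟩ := hys q hq
    have h0 : e 0 ∈ Submodule.span ℝ (range e) := Submodule.subset_span (mem_range_self 0)
    have h1 : e 1 ∈ Submodule.span ℝ (range e) := Submodule.subset_span (mem_range_self 1)
    exact add_mem (Submodule.smul_mem _ a h0) (Submodule.smul_mem _ c h1)
  exact ⟨OrthonormalBasis.mk he hspan, by simp [e], by simp [e]⟩

/-- If a finite group `Δ` leaves the orthogonal sum of two lines `X`, `Y` invariant, but not `X`, and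
a subgroup of `Δ` fixes `X` but not `Y` pointwise, then `Δ` acts on `X ⊔ Y` as a dihedral group. -/
theorem exists_actsAsDihedral {Δ S : Subgroup O4} [Finite Δ] {X Y : Submodule ℝ R4}
    (hX : Module.finrank ℝ X = 1) (hY : Module.finrank ℝ Y = 1) (hXY : X ⟂ Y)
    (hinv : IsInvariantUnder Δ (X ⊔ Y)) (hS : S ≤ Δ) (hXS : X ≤ fixSpace S)
    (hYS : ¬ Y ≤ fixSpace S) (hirr : ¬ IsInvariantUnder Δ X) :
    ∃ m, 3 ≤ m ∧ ActsAsDihedral Δ (X ⊔ Y) m := by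
  obtain ⟨x, hx, hx1, hxs⟩ := exists_unit_generator hX
  obtain ⟨y, hy, hy1, hys⟩ := exists_unit_generator hY
  have hxy : inner ℝ x y = 0 := Submodule.isOrtho_iff_inner_eq.1 hXY x hx y hy
  have hyx : inner ℝ y x = 0 := by rw [real_inner_comm, hxy]
  obtain ⟨b, hb0, hb1⟩ := exists_orthonormalBasis_sup hXY hx hy hx1 hy1 hxs hys
  -- Some `s` in `S` moves `y` and fixes `x`. Being an isometry of the plane, it sends `y` to `±y`,
  -- hence to `-y`.
  have hflip : ∃ g, planeRep hinv b g = flipMatrix := by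
    obtain ⟨s, hs, hsy⟩ : ∃ s ∈ S, s y ≠ y := by
      by_contra! hcon
      refine hYS fun z hz s hs => ?_
      obtain ⟨a, rfl⟩ := hys z hz
      rw [map_smul, hcon s hs]
    have hsx : s x = x := hXS hx s hs
    refine ⟨⟨s, hS hs⟩, ?_⟩
    have hxsy : inner ℝ x (s y) = 0 := by
      conv_lhs => rw [← hsx]
      rw [s.inner_map_map, hxy]
    have h := apply_basis_eq_sum hinv b ⟨s, hS hs⟩ 1
    simp only [Fin.sum_univ_two, planeRep_apply, hb0, hb1, hxsy, zero_smul, zero_add] at h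
    have habs : |inner ℝ y (s y)| = 1 := by
      have := congrArg norm h
      rwa [s.norm_map, norm_smul, hy1, mul_one, Real.norm_eq_abs, eq_comm] at this
    have hneg : inner ℝ y (s y) = (-1 : ℝ) := by
      rcases eq_or_eq_neg_of_abs_eq habs with h1 | h1
      · rw [h1, one_smul] at h
        exact absurd h hsy
      · exact h1
    ext i k
    rw [planeRep_apply]
    fin_cases i <;> fin_cases k <;> simp [hb0, hb1, hsx, hxsy, hneg, hyx, hx1, flipMatrix]
  -- The entry `1 0` is the `y`-component of the image of `x`; if it always vanished, `X` would be
  -- invariant.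
  have hmove : ∃ g, planeRep hinv b g 1 0 ≠ 0 := by
    by_contra! hcon
    refine hirr fun γ hγ z hz => ?_
    obtain ⟨a, rfl⟩ := hxs z hz
    have h := apply_basis_eq_sum hinv b ⟨γ, hγ⟩ 0
    rw [Fin.sum_univ_two, hcon, zero_smul, add_zero, hb0] at h
    rw [map_smul]
    refine X.smul_mem _ ?_
    change γ x = _ at h
    rw [h]
    exact X.smul_mem _ hx
  obtain ⟨m, hm, φ, hφ, hφρ⟩ := exists_dihedral_of_orthogonal_rep (planeRep hinv b)
    (planeRep_transpose_mul_self hinv b) hflip hmove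
  exact ⟨m, hm, b, φ, hφ, fun h k => by rw [apply_basis_eq_sum hinv b, hφρ]⟩

/-! ### Isotypic decompositions -/

/-- A module that is the sum of pairwise non-isomorphic simple submodules has these submodules as
its isotypic components. -/
theorem isotypicComponents_eq_range {R M ι : Type*} [Ring R] [AddCommGroup M] [Module R M]
    (N : ι → Submodule R M) (hsimple : ∀ i, IsSimpleModule R (N i)) (hsup : ⨆ i, N i = ⊤)
    (hne : Pairwise fun i k => IsEmpty (N i ≃ₗ[R] N k)) : isotypicComponents R M = range N := by
  have hmem (i : ι) : isotypicComponent R M (N i) ∈ isotypicComponents R M :=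
    ⟨N i, hsimple i, rfl⟩
  have hdist {i k : ι} (hik : i ≠ k) :
      isotypicComponent R M (N k) ≠ isotypicComponent R M (N i) := by
    intro h
    obtain ⟨e⟩ := isIsotypicOfType_submodule_iff.mp (.isotypicComponent R M (N k)) (N i)
      (h ▸ (N i).le_isotypicComponent)
    exact (hne hik).false e
  -- The other `N k` lie in other isotypic components, which are independent of that of `N i`. As
  -- all `N k` together span, the modular law leaves only `N i` in its component.
  have heq (i : ι) : isotypicComponent R M (N i) = N i := by
    refine le_antisymm ?_ (N i).le_isotypicComponent
    have hind := (sSupIndep_isotypicComponents R M) (hmem i)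
    have hle : ⨆ (k) (_ : k ≠ i), N k ≤
        sSup (isotypicComponents R M \ {isotypicComponent R M (N i)}) :=
      iSup₂_le fun k hk => (N k).le_isotypicComponent.trans
        (le_sSup ⟨hmem k, hdist hk.symm⟩)
    have htop : N i ⊔ ⨆ (k) (_ : k ≠ i), N k = ⊤ := by
      rw [eq_top_iff, ← hsup]
      refine iSup_le fun k => ?_
      by_cases hk : k = i
      · exact hk ▸ le_sup_left
      · exact (le_iSup₂_of_le (f := fun k (_ : k ≠ i) => N k) k hk le_rfl).trans le_sup_right
    have hmod : (N i ⊔ ⨆ (k) (_ : k ≠ i), N k) ⊓ isotypicComponent R M (N i) =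
        N i ⊔ (⨆ (k) (_ : k ≠ i), N k) ⊓ isotypicComponent R M (N i) :=
      sup_inf_assoc_of_le _ (N i).le_isotypicComponent
    rw [htop, top_inf_eq, (hind.mono_right hle).symm.eq_bot, sup_bot_eq] at hmod
    exact hmod.le
  ext c
  constructor
  · rintro ⟨S, hS, rfl⟩
    have : ∀ m : range N, IsSimpleModule R m := by
      rintro ⟨_, i, rfl⟩
      exact hsimple i
    obtain ⟨_, ⟨i, rfl⟩, ⟨e⟩⟩ := S.linearEquiv_of_sSup_eq_top (range N) hsup
    exact ⟨i, (heq i).symm.trans e.symm.isotypicComponent_eq⟩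
  · rintro ⟨i, rfl⟩
    rw [← heq i]
    exact hmem i

/-- An orthogonal sum of irreducible subspaces is the isotypic decomposition if any two summands
are told apart by the fixed vectors of a subgroup. -/
theorem isIsotypicDecomposition_of_fixSpace {H : Subgroup O4} {n : ℕ} {F : Fin n → Submodule ℝ R4}
    (hinv : ∀ i, IsInvariantUnder H (F i)) (hbot : ∀ i, F i ≠ ⊥)
    (hirr : ∀ i, ∀ E ≤ F i, IsInvariantUnder H E → E = ⊥ ∨ E = F i)
    (horth : ∀ i k, i < k → F i ⟂ F k) (hsup : ⨆ i, F i = ⊤)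
    (hdist : ∀ i k, i < k → ∃ S ≤ H, ¬(F i ⊓ fixSpace S = ⊥ ↔ F k ⊓ fixSpace S = ⊥)) :
    IsIsotypicDecomposition H F := by
  have horth' : Pairwise fun i k => F i ⟂ F k := fun i k hik =>
    (lt_or_gt_of_ne hik).elim (horth i k) fun h => (horth k i h).symm
  let ρ := naturalRep H
  have hmem {E : Submodule ℝ R4} : E ∈ ρ.invtSubmodule ↔ IsInvariantUnder H E := by
    rw [Representation.mem_invtSubmodule]
    exact ⟨fun h γ hγ x hx => h ⟨γ, hγ⟩ hx, fun h γ x hx => h γ γ.2 x hx⟩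
  let F' : Fin n → ρ.invtSubmodule := fun i => ⟨F i, hmem.2 (hinv i)⟩
  let N : Fin n → Submodule (MonoidAlgebra ℝ H) ρ.asModule := fun i => ρ.mapSubmodule (F' i)
  have hN {i : Fin n} {x : ρ.asModule} : x ∈ N i ↔ ρ.asModuleEquiv x ∈ F i := by
    constructor
    · rintro ⟨y, hy, rfl⟩
      simpa using hy
    · intro hx
      exact ⟨_, hx, by simp⟩
  have hmap (i : Fin n) :
      ((N i).restrictScalars ℝ).map ρ.asModuleEquiv.toLinearMap = F i := by
    ext x
    constructor
    · rintro ⟨y, hy, rfl⟩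
      exact hN.1 hy
    · intro hx
      exact ⟨ρ.asModuleEquiv.symm x, hN.2 (by simpa using hx), by simp⟩
  -- Invariant subspaces and submodules over the group algebra form isomorphic lattices, so
  -- irreducible subspaces correspond to atoms.
  have hsimple (i : Fin n) : IsSimpleModule (MonoidAlgebra ℝ H) (N i) := by
    rw [isSimpleModule_iff_isAtom]
    refine (OrderIso.isAtom_iff ρ.mapSubmodule (F' i)).2 ⟨fun h => hbot i (congrArg Subtype.val h), ?_⟩
    rintro ⟨E, hE⟩ hlt
    rcases hirr i E hlt.le (hmem.1 hE) with h | h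
    · exact Subtype.ext h
    · exact absurd (Subtype.ext h) hlt.ne
  have hsupN : ⨆ i, N i = ⊤ := by
    rw [eq_top_iff]
    intro x _
    have hle : (⊤ : Submodule ℝ R4) ≤
        ((⨆ i, N i).restrictScalars ℝ).map ρ.asModuleEquiv.toLinearMap := by
      rw [← hsup]
      refine iSup_le fun i => ?_
      rw [← hmap i]
      exact Submodule.map_mono fun y hy => (le_iSup N i) hy
    obtain ⟨y, hy, hyx⟩ := hle (Submodule.mem_top (x := ρ.asModuleEquiv x))
    rwa [← ρ.asModuleEquiv.injective hyx]
  -- An isomorphism of representations carries vectors fixed by `S` to vectors fixed by `S`.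
  have himp {i k : Fin n} (e : N i ≃ₗ[MonoidAlgebra ℝ H] N k) {S : Subgroup O4} (hS : S ≤ H)
      (h : F k ⊓ fixSpace S = ⊥) : F i ⊓ fixSpace S = ⊥ := by
    rw [eq_bot_iff]
    rintro x ⟨hxi, hxS⟩
    let x' : N i := ⟨ρ.asModuleEquiv.symm x, hN.2 (by simpa using hxi)⟩
    have hy : ρ.asModuleEquiv (e x' : ρ.asModule) ∈ F k ⊓ fixSpace S := by
      refine ⟨hN.1 (e x').2, fun s hs => ?_⟩
      have h1 : (MonoidAlgebra.of ℝ H ⟨s, hS hs⟩) • x' = x' := by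
        apply Subtype.ext
        have : (ρ ⟨s, hS hs⟩) x = x := hxS s hs
        rw [Submodule.coe_smul]
        change _ • ρ.asModuleEquiv.symm x = ρ.asModuleEquiv.symm x
        rw [← Representation.asModuleEquiv_symm_map_rho, this]
      have h2 := congrArg (fun z => ρ.asModuleEquiv (e z : ρ.asModule)) h1
      simp only [map_smul, Submodule.coe_smul, Representation.asModuleEquiv_map_smul,
        Representation.asAlgebraHom_of] at h2
      exact h2
    rw [h, Submodule.mem_bot, LinearEquiv.map_eq_zero_iff, Submodule.coe_eq_zero,
      LinearEquiv.map_eq_zero_iff] at hy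
    have := congrArg Subtype.val hy
    simpa [x'] using this
  refine ⟨fun i k hik => ?_, ?_, horth', hsup⟩
  · by_contra hne
    have : F i ⟂ F k := horth' hne
    rw [← hik, Submodule.isOrtho_self] at this
    exact hbot i this
  · rw [isotypicSubspaces, isotypicComponents_eq_range N hsimple hsupN, ← range_comp]
    · exact congrArg range (funext fun i => (hmap i).symm)
    · intro i k hik
      refine ⟨fun e => ?_⟩
      rcases lt_or_gt_of_ne hik with hlt | hlt
      · obtain ⟨S, hS, h⟩ := hdist i k hlt
        exact h ⟨himp e.symm hS, himp e hS⟩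
      · obtain ⟨S, hS, h⟩ := hdist k i hlt
        exact h ⟨himp e hS, himp e.symm hS⟩

/-- Exchanging the two planes produces the components in the order `L, W, V ⊔ T`; a permutation
restores the order wanted in the third type. -/
theorem IsIsotypicDecomposition.comp_equiv {H : Subgroup O4} {n : ℕ} {F : Fin n → Submodule ℝ R4}
    (h : IsIsotypicDecomposition H F) (σ : Equiv.Perm (Fin n)) :
    IsIsotypicDecomposition H (F ∘ σ) where
  injective := h.injective.comp σ.injective
  range_eq := by rw [σ.surjective.range_comp, h.range_eq]
  orthogonal _ _ hik := h.orthogonal (σ.injective.ne hik)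
  iSup_eq := by
    rw [← h.iSup_eq]
    exact σ.iSup_comp (g := F)

/-! ### Linear algebra of lines -/

theorem eq_bot_or_eq_of_le_line {X E : Submodule ℝ R4} (hX : Module.finrank ℝ X = 1) (hE : E ≤ X) :
    E = ⊥ ∨ E = X := by
  have h := Submodule.finrank_mono hE
  rcases Nat.eq_zero_or_pos (Module.finrank ℝ E) with h0 | h0
  · exact Or.inl (Submodule.finrank_eq_zero.1 h0)
  · exact Or.inr (Submodule.eq_of_le_of_finrank_eq hE (by omega))

theorem ne_bot_of_finrank_eq_one {X : Submodule ℝ R4} (hX : Module.finrank ℝ X = 1) : X ≠ ⊥ := by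
  rintro rfl
  simp at hX

theorem finrank_sup_of_inf_eq_bot {X Y : Submodule ℝ R4} (h : X ⊓ Y = ⊥) :
    Module.finrank ℝ ↥(X ⊔ Y) = Module.finrank ℝ X + Module.finrank ℝ Y := by
  have := Submodule.finrank_sup_add_finrank_inf_eq X Y
  rwa [h, finrank_bot, add_zero] at this

theorem exists_le_eigenspace_of_line {X : Submodule ℝ R4} (hX : Module.finrank ℝ X = 1)
    {J : Module.End ℝ R4} (hJ : ∀ x ∈ X, J x ∈ X) : ∃ a : ℝ, X ≤ J.eigenspace a := by
  obtain ⟨x, hx, -, hxs⟩ := exists_unit_generator hX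
  obtain ⟨a, ha⟩ := hxs _ (hJ x hx)
  refine ⟨a, fun z hz => ?_⟩
  obtain ⟨c, rfl⟩ := hxs z hz
  rw [Module.End.mem_eigenspace_iff, map_smul, ha, smul_comm]

theorem inf_eigenspace_eq_bot {X : Submodule ℝ R4} {J : Module.End ℝ R4} {a b : ℝ} (hab : a ≠ b)
    (hX : X ≤ J.eigenspace a) : X ⊓ J.eigenspace b = ⊥ := by
  rw [eq_bot_iff]
  rintro x ⟨hx, hb⟩
  have ha := Module.End.mem_eigenspace_iff.1 (hX hx)
  have hb := Module.End.mem_eigenspace_iff.1 hb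
  have : (a - b) • x = 0 := by rw [sub_smul, ← ha, hb, sub_self]
  exact (smul_eq_zero.1 this).resolve_left (sub_ne_zero.2 hab)

/-- The characteristic polynomial of a map with an orthogonal frame of eigenlines. -/
theorem charpoly_eq_of_orthogonal_eigenlines {J : Module.End ℝ R4} {F : Fin 4 → Submodule ℝ R4}
    {a : Fin 4 → ℝ} (hF : ∀ i, Module.finrank ℝ (F i) = 1) (horth : Pairwise fun i k => F i ⟂ F k)
    (heig : ∀ i, F i ≤ J.eigenspace (a i)) :
    J.charpoly = ∏ i, (Polynomial.X - Polynomial.C (a i)) := by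
  choose e he he1 _ using fun i => exists_unit_generator (hF i)
  have hon : Orthonormal ℝ e :=
    ⟨he1, fun i k hik => Submodule.isOrtho_iff_inner_eq.1 (horth hik) _ (he i) _ (he k)⟩
  let b := basisOfOrthonormalOfCardEqFinrank hon (by simp)
  have hb : ⇑b = e := coe_basisOfOrthonormalOfCardEqFinrank hon (by simp)
  have hmat : LinearMap.toMatrix b b J = Matrix.diagonal a := by
    ext i k
    have hk : J (b k) = a k • b k := by
      rw [hb]
      exact Module.End.mem_eigenspace_iff.1 (heig k (he k))
    rw [LinearMap.toMatrix_apply, hk, map_smul, Module.Basis.repr_self, Matrix.diagonal_apply]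
    by_cases hik : i = k
    · simp [hik]
    · simp [hik]
  rw [← LinearMap.charpoly_toMatrix J b, hmat, Matrix.charpoly_diagonal]

/-! ### Two fixed planes that meet in a line -/

/-- `L`, `V`, `W`, `T` are the radial, first, second and transverse direction of two fixed planes
`Fix(S₁)`, `Fix(S₂)` that meet in the line `L = Fix(Δ)`. -/
structure IsAxisFrame (Δ S₁ S₂ : Subgroup O4) (L V W T : Submodule ℝ R4) : Prop where
  le₁ : S₁ ≤ Δ
  le₂ : S₂ ≤ Δ
  fix_eq : fixSpace Δ = L
  inf_eq : fixSpace S₁ ⊓ fixSpace S₂ = L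
  V_eq : V = fixSpace S₁ ⊓ Lᗮ
  W_eq : W = fixSpace S₂ ⊓ Lᗮ
  T_eq : T = (L ⊔ V ⊔ W)ᗮ
  finrank_L : Module.finrank ℝ L = 1
  finrank_V : Module.finrank ℝ V = 1
  finrank_W : Module.finrank ℝ W = 1

namespace IsAxisFrame

variable {Δ S₁ S₂ : Subgroup O4} {L V W T : Submodule ℝ R4}

/-- Lets each statement about `V` and `S₁` serve also for `W` and `S₂`. -/
protected theorem symm (h : IsAxisFrame Δ S₁ S₂ L V W T) : IsAxisFrame Δ S₂ S₁ L W V T where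
  le₁ := h.le₂
  le₂ := h.le₁
  fix_eq := h.fix_eq
  inf_eq := by rw [inf_comm, h.inf_eq]
  V_eq := h.W_eq
  W_eq := h.V_eq
  T_eq := by rw [h.T_eq, sup_right_comm]
  finrank_L := h.finrank_L
  finrank_V := h.finrank_W
  finrank_W := h.finrank_V

variable (h : IsAxisFrame Δ S₁ S₂ L V W T)
include h

theorem L_le : L ≤ fixSpace S₁ := h.inf_eq ▸ inf_le_left

theorem V_le : V ≤ fixSpace S₁ := h.V_eq ▸ inf_le_left

theorem L_sup_V : L ⊔ V = fixSpace S₁ := by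
  rw [h.V_eq, inf_comm]
  exact Submodule.sup_orthogonal_inf_of_hasOrthogonalProjection h.L_le

theorem L_ortho_V : L ⟂ V := by
  rw [Submodule.isOrtho_comm, Submodule.isOrtho_iff_le, h.V_eq]
  exact inf_le_right

theorem T_le : T ≤ (fixSpace S₁)ᗮ := by
  rw [h.T_eq, h.L_sup_V]
  exact Submodule.orthogonal_le le_sup_left

/-- Shows that `T` is preserved by maps commuting with `Δ`, at a stage where `V ⟂ W` is not yet
known. -/
theorem T_eq_inf : T = (fixSpace S₁)ᗮ ⊓ (fixSpace S₂)ᗮ := by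
  rw [Submodule.inf_orthogonal, ← h.L_sup_V, ← h.symm.L_sup_V, h.T_eq]
  congr 1
  refine le_antisymm (sup_le le_sup_left (le_sup_of_le_right le_sup_right)) ?_
  exact sup_le le_sup_left (sup_le (le_sup_of_le_left le_sup_left) le_sup_right)

theorem ortho_T : fixSpace S₁ ⟂ T := by
  rw [Submodule.isOrtho_comm, Submodule.isOrtho_iff_le]
  exact h.T_le

theorem fix_inf_W : fixSpace S₁ ⊓ W = ⊥ := by
  rw [h.W_eq, ← inf_assoc, h.inf_eq, Submodule.inf_orthogonal_eq_bot]

theorem finrank_T : Module.finrank ℝ T = 1 := by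
  have h1 : Module.finrank ℝ ↥(L ⊔ V) = 2 := by
    rw [finrank_sup_of_inf_eq_bot h.L_ortho_V.disjoint.eq_bot, h.finrank_L, h.finrank_V]
  have h2 : Module.finrank ℝ ↥(L ⊔ V ⊔ W) = 3 := by
    rw [finrank_sup_of_inf_eq_bot (h.L_sup_V ▸ h.fix_inf_W), h1, h.finrank_W]
  have h3 := Submodule.finrank_add_finrank_orthogonal (L ⊔ V ⊔ W)
  rw [h2, ← h.T_eq, finrank_euclideanSpace_fin] at h3
  omega

theorem finrank_orthogonal : Module.finrank ℝ Lᗮ = 3 := by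
  have h3 := Submodule.finrank_add_finrank_orthogonal L
  rw [h.finrank_L, finrank_euclideanSpace_fin] at h3
  omega

theorem invariant_L : IsInvariantUnder Δ L := h.fix_eq ▸ isInvariantUnder_fixSpace

/-- An invariant subspace of `Lᗮ` contains `V` or is orthogonal to `Fix(S₁)`. -/
theorem V_le_or_ortho [Finite Δ] {E : Submodule ℝ R4} (hE : IsInvariantUnder Δ E) (hEL : E ≤ Lᗮ) :
    V ≤ E ∨ E ⟂ fixSpace S₁ := by
  have : Finite S₁ := Finite.of_injective _ (Subgroup.inclusion_injective h.le₁)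
  -- `V` is a line, so this intersection is `V` or zero; in the latter case averaging over `S₁`
  -- gives orthogonality.
  have hle : E ⊓ fixSpace S₁ ≤ V := by
    rw [h.V_eq]
    exact le_inf inf_le_right (inf_le_left.trans hEL)
  rcases eq_bot_or_eq_of_le_line h.finrank_V hle with h0 | h0
  · exact Or.inr (isOrtho_fixSpace (hE.mono h.le₁) h0)
  · exact Or.inl (h0 ▸ inf_le_left)

theorem exists_le_eigenspace_L {J : Module.End ℝ R4} (hJ : CommutesWith Δ J) :
    ∃ a : ℝ, L ≤ J.eigenspace a :=
  exists_le_eigenspace_of_line h.finrank_L fun _ hx =>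
    h.fix_eq ▸ map_mem_fixSpace hJ (h.fix_eq.symm ▸ hx)

theorem invariant_eigenspace_inf {J : Module.End ℝ R4} (hJ : CommutesWith Δ J) (a : ℝ) :
    IsInvariantUnder Δ (J.eigenspace a ⊓ Lᗮ) :=
  (isInvariantUnder_eigenspace hJ a).inf h.invariant_L.orthogonal

section Commuting

variable [Finite Δ] {J : Module.End ℝ R4} (hJ : CommutesWith Δ J)
include hJ

theorem map_mem_orthogonal {x : R4} (hx : x ∈ (fixSpace S₁)ᗮ) : J x ∈ (fixSpace S₁)ᗮ := by
  have : Finite S₁ := Finite.of_injective _ (Subgroup.inclusion_injective h.le₁)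
  exact map_mem_fixSpace_orthogonal (fun γ hγ => hJ γ (h.le₁ hγ)) hx

theorem exists_le_eigenspace_V : ∃ a : ℝ, V ≤ J.eigenspace a := by
  refine exists_le_eigenspace_of_line h.finrank_V fun x hx => ?_
  rw [h.V_eq] at hx ⊢
  refine ⟨map_mem_fixSpace (fun γ hγ => hJ γ (h.le₁ hγ)) hx.1, ?_⟩
  have hx2 := hx.2
  rw [← h.fix_eq] at hx2 ⊢
  exact map_mem_fixSpace_orthogonal hJ hx2

theorem exists_le_eigenspace_T : ∃ a : ℝ, T ≤ J.eigenspace a := by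
  refine exists_le_eigenspace_of_line h.finrank_T fun x hx => ?_
  rw [h.T_eq_inf] at hx ⊢
  exact ⟨h.map_mem_orthogonal hJ hx.1, h.symm.map_mem_orthogonal hJ hx.2⟩

variable {a b : ℝ} (hV : V ≤ J.eigenspace a) (hW : W ≤ J.eigenspace b) (hab : a ≠ b)

include hV hab

/-- The eigenspace part in `Lᗮ` is `Δ`-invariant and cannot contain `V`, on which `J` is `a ≠ b`; so
`V_le_or_ortho` leaves one alternative. -/
theorem eigenspace_inf_ortho : J.eigenspace b ⊓ Lᗮ ⟂ fixSpace S₁ := by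
  refine (h.V_le_or_ortho (h.invariant_eigenspace_inf hJ b) inf_le_right).resolve_left fun hle => ?_
  refine ne_bot_of_finrank_eq_one h.finrank_V (eq_bot_iff.2 ?_)
  rw [← inf_eigenspace_eq_bot hab hV]
  exact le_inf le_rfl (hle.trans inf_le_left)

include hW

/-- `J` need not be symmetric: the orthogonality comes from the group action on the eigenspace
containing `W`. -/
theorem V_ortho_W : V ⟂ W := by
  refine (Submodule.IsOrtho.mono ?_ h.V_le (h.eigenspace_inf_ortho hJ hV hab)).symm
  exact le_inf hW (h.W_eq ▸ inf_le_right)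

end Commuting

-- Isotypic types of an axis frame.

end IsAxisFrame

namespace IsAxisFrame

variable {Δ S₁ S₂ : Subgroup O4} {L V W T : Submodule ℝ R4}
variable (h : IsAxisFrame Δ S₁ S₂ L V W T)
include h

theorem L_ortho_T : L ⟂ T := h.ortho_T.mono_left h.L_le

theorem V_ortho_T : V ⟂ T := h.ortho_T.mono_left h.V_le

theorem inf_fix_ne_bot_L : L ⊓ fixSpace Δ ≠ ⊥ := by
  rw [h.fix_eq, inf_idem]
  exact ne_bot_of_finrank_eq_one h.finrank_L

theorem inf_fix_ne_bot_V : V ⊓ fixSpace S₁ ≠ ⊥ := by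
  rw [inf_eq_left.2 h.V_le]
  exact ne_bot_of_finrank_eq_one h.finrank_V

theorem sup_eq_top : L ⊔ V ⊔ W ⊔ T = ⊤ := by
  rw [h.T_eq]
  exact Submodule.sup_orthogonal_of_hasOrthogonalProjection

theorem inf_fix_eq_bot {E : Submodule ℝ R4} (hE : L ⟂ E) : E ⊓ fixSpace Δ = ⊥ := by
  rw [h.fix_eq]
  exact hE.symm.disjoint.eq_bot

theorem finrank_sup : Module.finrank ℝ ↥(W ⊔ T) = 2 := by
  rw [finrank_sup_of_inf_eq_bot h.symm.V_ortho_T.disjoint.eq_bot, h.finrank_W, h.finrank_T]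

variable (hVW : V ⟂ W)
include hVW

theorem V_ortho_sup : V ⟂ W ⊔ T := Submodule.isOrtho_sup_right.2 ⟨hVW, h.V_ortho_T⟩

theorem fix_ortho_sup : fixSpace S₁ ⟂ W ⊔ T := by
  rw [← h.L_sup_V, Submodule.isOrtho_sup_left]
  exact ⟨Submodule.isOrtho_sup_right.2 ⟨h.symm.L_ortho_V, h.L_ortho_T⟩, h.V_ortho_sup hVW⟩

theorem orthogonal_fix : (fixSpace S₁)ᗮ = W ⊔ T := by
  symm
  refine Submodule.eq_of_le_of_finrank_eq (Submodule.isOrtho_iff_le.1 (h.fix_ortho_sup hVW).symm) ?_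
  have h1 : Module.finrank ℝ (fixSpace S₁) = 2 := by
    rw [← h.L_sup_V, finrank_sup_of_inf_eq_bot h.L_ortho_V.disjoint.eq_bot, h.finrank_L,
      h.finrank_V]
  have h2 := Submodule.finrank_add_finrank_orthogonal (fixSpace S₁)
  rw [h1, finrank_euclideanSpace_fin] at h2
  rw [h.finrank_sup]
  omega

theorem sup_le_orthogonal : W ⊔ T ≤ Lᗮ :=
  Submodule.isOrtho_iff_le.1 ((h.fix_ortho_sup hVW).mono_left h.L_le).symm

theorem pairwise_ortho : Pairwise fun i k => ![L, V, W, T] i ⟂ ![L, V, W, T] k := by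
  intro i k hik
  fin_cases i <;> fin_cases k
  exacts [absurd rfl hik, h.L_ortho_V, h.symm.L_ortho_V, h.L_ortho_T, h.L_ortho_V.symm,
    absurd rfl hik, hVW, h.V_ortho_T, h.symm.L_ortho_V.symm, hVW.symm, absurd rfl hik,
    h.symm.V_ortho_T, h.L_ortho_T.symm, h.V_ortho_T.symm, h.symm.V_ortho_T.symm, absurd rfl hik]

/-- If `V` and `W` are invariant, all four lines are isotypic components. -/
theorem isIsotypicDecomposition_four (hV : IsInvariantUnder Δ V) (hW : IsInvariantUnder Δ W) :
    IsIsotypicDecomposition Δ ![L, V, W, T] := by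
  have hT : IsInvariantUnder Δ T := by
    rw [h.T_eq]
    exact ((h.invariant_L.sup hV).sup hW).orthogonal
  have hrank : ∀ i, Module.finrank ℝ (![L, V, W, T] i) = 1 := by
    intro i
    fin_cases i
    exacts [h.finrank_L, h.finrank_V, h.finrank_W, h.finrank_T]
  refine isIsotypicDecomposition_of_fixSpace ?_ (fun i => ne_bot_of_finrank_eq_one (hrank i))
    (fun i E hE _ => eq_bot_or_eq_of_le_line (hrank i) hE)
    (fun i k hik => h.pairwise_ortho hVW hik.ne) ?_ ?_
  · intro i
    fin_cases i
    exacts [h.invariant_L, hV, hW, hT]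
  · rw [eq_top_iff, ← h.sup_eq_top]
    exact sup_le (sup_le (sup_le (le_iSup ![L, V, W, T] 0) (le_iSup ![L, V, W, T] 1))
      (le_iSup ![L, V, W, T] 2)) (le_iSup ![L, V, W, T] 3)
  -- `Δ` tells `L` from the other lines, `S₁` tells `V` from `W` and `T`, and `S₂` tells `W` from
  -- `T`.
  · have dL {E : Submodule ℝ R4} (hE : L ⟂ E) :
        ∃ S ≤ Δ, ¬(L ⊓ fixSpace S = ⊥ ↔ E ⊓ fixSpace S = ⊥) :=
      ⟨Δ, le_rfl, fun e => h.inf_fix_ne_bot_L (e.2 (h.inf_fix_eq_bot hE))⟩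
    have hWS : W ⊓ fixSpace S₁ = ⊥ := inf_comm W _ ▸ h.fix_inf_W
    have hTS : T ⊓ fixSpace S₁ = ⊥ := h.ortho_T.symm.disjoint.eq_bot
    have hTS' : T ⊓ fixSpace S₂ = ⊥ := h.symm.ortho_T.symm.disjoint.eq_bot
    intro i k hik
    fin_cases i <;> fin_cases k <;> first | exact absurd hik (by decide) | skip
    exacts [dL h.L_ortho_V, dL h.symm.L_ortho_V, dL h.L_ortho_T,
      ⟨S₁, h.le₁, fun e => h.inf_fix_ne_bot_V (e.2 hWS)⟩,
      ⟨S₁, h.le₁, fun e => h.inf_fix_ne_bot_V (e.2 hTS)⟩,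
      ⟨S₂, h.le₂, fun e => h.symm.inf_fix_ne_bot_V (e.2 hTS')⟩]

theorem invariant_sup (hV : IsInvariantUnder Δ V) : IsInvariantUnder Δ (W ⊔ T) := by
  rw [← h.orthogonal_fix hVW, ← h.L_sup_V]
  exact (h.invariant_L.sup hV).orthogonal

variable [Finite Δ]

/-- If `V` is invariant and `W` is not, the plane `W ⊔ T` is irreducible. -/
theorem eq_bot_or_eq_sup (hW : ¬ IsInvariantUnder Δ W)
    (hU : IsInvariantUnder Δ (W ⊔ T)) {E : Submodule ℝ R4} (hE : E ≤ W ⊔ T)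
    (hEΔ : IsInvariantUnder Δ E) : E = ⊥ ∨ E = W ⊔ T := by
  -- An invariant subspace containing `W` cannot equal `W`, so it fills the plane.
  have key {E : Submodule ℝ R4} (hE : E ≤ W ⊔ T) (hEΔ : IsInvariantUnder Δ E) (hWE : W ≤ E) :
      E = W ⊔ T := by
    refine Submodule.eq_of_le_of_finrank_le hE ?_
    rw [h.finrank_sup]
    by_contra! hlt
    have h1 := Submodule.finrank_mono hWE
    have h2 : W = E := Submodule.eq_of_le_of_finrank_le hWE (by rw [h.finrank_W]; omega)
    exact hW (h2 ▸ hEΔ)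
  rcases h.symm.V_le_or_ortho hEΔ (hE.trans (h.sup_le_orthogonal hVW)) with h1 | h1
  · exact Or.inr (key hE hEΔ h1)
  · left
    -- Here the complement of `E` in the plane contains `W`, hence is the whole plane, and `E` is
    -- orthogonal to itself.
    have h2 := key (E := Eᗮ ⊓ (W ⊔ T)) inf_le_right (hEΔ.orthogonal.inf hU)
      (le_inf (Submodule.isOrtho_iff_le.1 (h1.mono_right h.symm.V_le).symm) le_sup_left)
    have h3 : E ≤ Eᗮ := hE.trans (inf_eq_right.1 h2)
    exact Submodule.isOrtho_self.1 (Submodule.isOrtho_iff_le.2 h3)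

/-- If `V` is invariant and `W` is not, the isotypic components are `L`, `V` and `W ⊔ T`. -/
theorem isIsotypicDecomposition_three (hV : IsInvariantUnder Δ V) (hW : ¬ IsInvariantUnder Δ W) :
    IsIsotypicDecomposition Δ ![L, V, W ⊔ T] := by
  have hU := h.invariant_sup hVW hV
  have hLU : L ⟂ W ⊔ T := (h.fix_ortho_sup hVW).mono_left h.L_le
  refine isIsotypicDecomposition_of_fixSpace ?_ ?_ ?_ ?_ ?_ ?_
  · intro i
    fin_cases i
    exacts [h.invariant_L, hV, hU]
  · intro i
    fin_cases i
    exacts [ne_bot_of_finrank_eq_one h.finrank_L, ne_bot_of_finrank_eq_one h.finrank_V,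
      ne_bot_of_le_ne_bot (ne_bot_of_finrank_eq_one h.finrank_W) le_sup_left]
  · intro i E hE hEΔ
    fin_cases i
    exacts [eq_bot_or_eq_of_le_line h.finrank_L hE, eq_bot_or_eq_of_le_line h.finrank_V hE,
      h.eq_bot_or_eq_sup hVW hW hU hE hEΔ]
  · intro i k hik
    fin_cases i <;> fin_cases k <;> first | exact absurd hik (by decide) | skip
    exacts [h.L_ortho_V, hLU, h.V_ortho_sup hVW]
  · rw [eq_top_iff, ← h.sup_eq_top, sup_assoc (L ⊔ V)]
    exact sup_le (sup_le (le_iSup ![L, V, W ⊔ T] 0) (le_iSup ![L, V, W ⊔ T] 1))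
      (le_iSup ![L, V, W ⊔ T] 2)
  · have dL {E : Submodule ℝ R4} (hE : L ⟂ E) :
        ∃ S ≤ Δ, ¬(L ⊓ fixSpace S = ⊥ ↔ E ⊓ fixSpace S = ⊥) :=
      ⟨Δ, le_rfl, fun e => h.inf_fix_ne_bot_L (e.2 (h.inf_fix_eq_bot hE))⟩
    have hUS : (W ⊔ T) ⊓ fixSpace S₁ = ⊥ := (h.fix_ortho_sup hVW).symm.disjoint.eq_bot
    intro i k hik
    fin_cases i <;> fin_cases k <;> first | exact absurd hik (by decide) | skip
    exacts [dL h.L_ortho_V, dL hLU, ⟨S₁, h.le₁, fun e => h.inf_fix_ne_bot_V (e.2 hUS)⟩]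

/-- The reflection is supplied by `S₂`, which fixes `W` pointwise but, since `T ⟂ Fix(S₂)`, not `T`.
-/
theorem exists_actsAsDihedral_sup (hV : IsInvariantUnder Δ V) (hW : ¬ IsInvariantUnder Δ W) :
    ∃ m, 3 ≤ m ∧ ActsAsDihedral Δ (W ⊔ T) m := by
  refine exists_actsAsDihedral h.finrank_W h.finrank_T h.symm.V_ortho_T (h.invariant_sup hVW hV)
    h.le₂ h.symm.V_le (fun hle => ?_) hW
  refine ne_bot_of_finrank_eq_one h.finrank_T ?_
  rw [← inf_eq_left.2 hle]
  exact h.symm.ortho_T.symm.disjoint.eq_bot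

variable {J : Module.End ℝ R4} (hJ : CommutesWith Δ J) {a b : ℝ}
  (hVa : V ≤ J.eigenspace a) (hWb : W ≤ J.eigenspace b) (hab : a ≠ b)
include hJ hVa hWb hab

/-- The left side is a nonzero invariant subspace of the irreducible plane. This is the source of
the double eigenvalue. -/
theorem eigenspace_inf_orthogonal (hV : IsInvariantUnder Δ V) (hW : ¬ IsInvariantUnder Δ W) :
    J.eigenspace b ⊓ Lᗮ = W ⊔ T := by
  refine (h.eq_bot_or_eq_sup hVW hW (h.invariant_sup hVW hV) ?_
    (h.invariant_eigenspace_inf hJ b)).resolve_left ?_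
  · rw [← h.orthogonal_fix hVW]
    exact Submodule.isOrtho_iff_le.1 (h.eigenspace_inf_ortho hJ hVa hab)
  · refine ne_bot_of_le_ne_bot (ne_bot_of_finrank_eq_one h.finrank_W) (le_inf hWb ?_)
    exact h.W_eq ▸ inf_le_right

omit hVW [Finite Δ] in
-- A non-invariant eigenline forces its eigenspace in `Lᗮ` to have dimension at least 2; two such
-- eigenspaces do not fit into dimension 3.
theorem invariant_V_or_invariant_W : IsInvariantUnder Δ V ∨ IsInvariantUnder Δ W := by
  by_contra! hcon
  have key {X : Submodule ℝ R4} {c : ℝ} (hX : Module.finrank ℝ X = 1)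
      (hle : X ≤ J.eigenspace c ⊓ Lᗮ) (hinv : ¬ IsInvariantUnder Δ X) :
      2 ≤ Module.finrank ℝ ↥(J.eigenspace c ⊓ Lᗮ) := by
    by_contra! hlt
    exact hinv (Submodule.eq_of_le_of_finrank_le hle (by omega) ▸ h.invariant_eigenspace_inf hJ c)
  have h1 := key h.finrank_V (le_inf hVa (h.V_eq ▸ inf_le_right)) hcon.1
  have h2 := key h.finrank_W (le_inf hWb (h.W_eq ▸ inf_le_right)) hcon.2
  have h3 : (J.eigenspace a ⊓ Lᗮ) ⊓ (J.eigenspace b ⊓ Lᗮ) = ⊥ := by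
    rw [eq_bot_iff, ← inf_eigenspace_eq_bot hab (le_refl (J.eigenspace a))]
    exact inf_le_inf inf_le_left inf_le_left
  have h4 := finrank_sup_of_inf_eq_bot h3
  have h5 := Submodule.finrank_mono
    (sup_le inf_le_right inf_le_right : J.eigenspace a ⊓ Lᗮ ⊔ J.eigenspace b ⊓ Lᗮ ≤ Lᗮ)
  rw [h4, h.finrank_orthogonal] at h5
  omega

end IsAxisFrame

/-! ### Robust heteroclinic cycles -/

section Cycle

variable {M : ℕ} {Γ : Subgroup O4} {f : R4 → R4} {ξ : ZMod M → R4} {Sg : ZMod M → Subgroup O4}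

/-- A trajectory through an equilibrium is constant, so it cannot have the other equilibrium as its
limit. -/
theorem IsHeteroclinicCycle.ne_of_mem_connection (hc : IsHeteroclinicCycle f ξ)
    (hf : ContDiff ℝ 1 f) {j : ZMod M} {x : R4} (hx : x ∈ connection f ξ j) :
    x ≠ ξ j ∧ x ≠ ξ (j + 1) := by
  obtain ⟨⟨u, hu0, hu, hul⟩, v, hv0, hv, hvl⟩ := hx
  constructor
  · rintro rfl
    exact hc.ne j (eq_of_tendsto_atTop_of_equilibrium hf (hc.hyperbolic j).1 hv hv0 hvl)
  · rintro rfl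
    exact hc.ne j (eq_of_tendsto_atBot_of_equilibrium hf (hc.hyperbolic (j + 1)).1 hu hu0 hul).symm

theorem isPreconnected_diff_zero {P : Submodule ℝ R4} (hP : Module.finrank ℝ P = 2) :
    IsPreconnected ((P : Set R4) \ {0}) := by
  have hrank : 1 < Module.rank ℝ P := by
    rw [← Module.finrank_eq_rank, hP]
    norm_num
  have h := (isConnected_compl_singleton_of_one_lt_rank hrank 0).isPreconnected.image
    ((↑) : P → R4) continuous_subtype_val.continuousOn
  convert h using 1
  ext x
  constructor
  · rintro ⟨hx, hx0⟩
    exact ⟨⟨x, hx⟩, by simpa [Subtype.ext_iff] using hx0, rfl⟩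
  · rintro ⟨y, hy, rfl⟩
    exact ⟨y.2, by simpa using hy⟩

theorem IsRobustCycle.mem_left (hc : IsRobustCycle Γ f ξ Sg) (j : ZMod M) :
    ξ j ∈ fixSpace (Sg (j - 1)) := by
  simpa using (hc.sink (j - 1)).1

/-- Consecutive fixed planes of the cycle do not coincide. -/
theorem IsRobustCycle.spaceP_ne (hc : IsRobustCycle Γ f ξ Sg) (hf : ContDiff ℝ 1 f)
    (hP : ∀ j, Module.finrank ℝ (spaceP Sg j) = 2)
    (hone : ∀ j, ∀ x ∈ (spaceL Sg j : Set R4) \ {0},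
      (cycleSet f ξ ∩ connectedComponentIn ((spaceL Sg j : Set R4) \ {0}) x).Subsingleton)
    (j : ZMod M) : spaceP Sg (j - 1) ≠ spaceP Sg j := by
  intro heq
  have hLP : spaceL Sg j = spaceP Sg j := by rw [spaceL, heq, inf_idem]
  -- The punctured plane is a single component, so it contains at most one point of the cycle.
  have huniq {x y : R4} (hx : x ∈ spaceP Sg j) (hx0 : x ≠ 0) (hxc : x ∈ cycleSet f ξ)
      (hy : y ∈ spaceP Sg j) (hy0 : y ≠ 0) (hyc : y ∈ cycleSet f ξ) : x = y := by
    have hsub := (isPreconnected_diff_zero (hP j)).subset_connectedComponentIn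
      (⟨hx, hx0⟩ : x ∈ (spaceP Sg j : Set R4) \ {0}) subset_rfl
    have := hone j x (by rw [hLP]; exact ⟨hx, hx0⟩)
    rw [hLP] at this
    exact this ⟨hxc, hsub ⟨hx, hx0⟩⟩ ⟨hyc, hsub ⟨hy, hy0⟩⟩
  obtain ⟨x, hx⟩ := hc.connected j
  obtain ⟨h1, h2⟩ := hc.ne_of_mem_connection hf hx
  have h3 := hc.ne j
  have mx : x ∈ spaceP Sg j := hc.connection_subset j hx
  have m1 : ξ j ∈ spaceP Sg j := hc.mem j
  have m2 : ξ (j + 1) ∈ spaceP Sg j := (hc.sink j).1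
  have cx : x ∈ cycleSet f ξ := Or.inr (mem_iUnion.2 ⟨j, hx⟩)
  have c1 : ξ j ∈ cycleSet f ξ := Or.inl (mem_range_self j)
  have c2 : ξ (j + 1) ∈ cycleSet f ξ := Or.inl (mem_range_self (j + 1))
  -- Of the three distinct points `ξ j`, `x`, `ξ (j + 1)` at most one is `0`; the two others
  -- contradict uniqueness.
  by_cases hx0 : x = 0
  · exact h3 (huniq m1 (fun h => h1 (hx0.trans h.symm)) c1 m2 (fun h => h2 (hx0.trans h.symm)) c2)
  · by_cases h10 : ξ j = 0
    · exact h2 (huniq mx hx0 cx m2 (fun h => h3 (h10.trans h.symm)) c2)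
    · exact h1 (huniq mx hx0 cx m1 h10 c1)

theorem finrank_inf_orthogonal_eq_one {P L : Submodule ℝ R4} (hP : Module.finrank ℝ P = 2)
    (hL : Module.finrank ℝ L = 1) (hLP : L ≤ P) : Module.finrank ℝ ↥(P ⊓ Lᗮ) = 1 := by
  have h := Submodule.finrank_add_inf_finrank_orthogonal hLP
  rw [inf_comm, hL, hP] at h
  omega

theorem IsRobustCycle.isAxisFrame (hc : IsRobustCycle Γ f ξ Sg) (hf : ContDiff ℝ 1 f)
    (hP : ∀ j, Module.finrank ℝ (spaceP Sg j) = 2)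
    (hone : ∀ j, ∀ x ∈ (spaceL Sg j : Set R4) \ {0},
      (cycleSet f ξ ∩ connectedComponentIn ((spaceL Sg j : Set R4) \ {0}) x).Subsingleton)
    {j : ZMod M} (hL : spaceL Sg j ≠ ⊥) :
    IsAxisFrame (groupDelta Γ Sg j) (Sg (j - 1)) (Sg j) (spaceL Sg j) (spaceV Sg j) (spaceW Sg j)
      (spaceT Sg j) := by
  have hle₁ : spaceL Sg j ≤ spaceP Sg (j - 1) := inf_le_left
  have hle₂ : spaceL Sg j ≤ spaceP Sg j := inf_le_right
  have hdim : Module.finrank ℝ (spaceL Sg j) = 1 := by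
    have h1 : Module.finrank ℝ (spaceL Sg j) ≠ 0 := fun h => hL (Submodule.finrank_eq_zero.1 h)
    have h2 : ¬ 2 ≤ Module.finrank ℝ (spaceL Sg j) := fun h =>
      hc.spaceP_ne hf hP hone j
        ((Submodule.eq_of_le_of_finrank_le hle₁ (by rwa [hP])).symm.trans
          (Submodule.eq_of_le_of_finrank_le hle₂ (by rwa [hP])))
    omega
  exact
    { le₁ := fun s hs => ⟨hc.le _ hs, fun x hx => hx.1 s hs⟩
      le₂ := fun s hs => ⟨hc.le _ hs, fun x hx => hx.2 s hs⟩
      fix_eq := fixSpace_groupDelta Γ Sg j hc.le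
      inf_eq := rfl
      V_eq := rfl
      W_eq := rfl
      T_eq := rfl
      finrank_L := hdim
      finrank_V := finrank_inf_orthogonal_eq_one (hP (j - 1)) hdim hle₁
      finrank_W := finrank_inf_orthogonal_eq_one (hP j) hdim hle₂ }

theorem hasComplexEigenvalueOn_of_line {A : R4 →L[ℝ] R4} {P X : Submodule ℝ R4} {a : ℝ}
    (hX : Module.finrank ℝ X = 1) (hXP : X ≤ P)
    (hXa : X ≤ Module.End.eigenspace (A.toLinearMap : Module.End ℝ R4) a) :
    HasComplexEigenvalueOn A P a := by
  obtain ⟨x, hx, hx0⟩ := X.exists_mem_ne_zero_of_ne_bot (ne_bot_of_finrank_eq_one hX)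
  have h : A x = a • x := Module.End.mem_eigenspace_iff.1 (hXa hx)
  exact ⟨x, hXP hx, 0, P.zero_mem, Or.inl hx0, by simp [h], by simp⟩

/-- Orthogonality of the eigenspaces is what lets eigenvalues bound the quadratic form; negative
eigenvalues then give the definiteness needed in `eq_of_tendsto_atBot_of_negDef`. -/
theorem inner_map_self_le_of_eigenspaces {E : Type*} [NormedAddCommGroup E] [InnerProductSpace ℝ E]
    {A : Module.End ℝ E} {X Y : Submodule ℝ E} {a b : ℝ} (hXY : X ⟂ Y)
    (hX : X ≤ A.eigenspace a) (hY : Y ≤ A.eigenspace b) {z : E} (hz : z ∈ X ⊔ Y) :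
    inner ℝ (A z) z ≤ max a b * ‖z‖ ^ 2 := by
  obtain ⟨x, hx, y, hy, rfl⟩ := Submodule.mem_sup.1 hz
  have hxy : inner ℝ x y = 0 := Submodule.isOrtho_iff_inner_eq.1 hXY x hx y hy
  have hyx : inner ℝ y x = 0 := by rw [real_inner_comm, hxy]
  rw [map_add, Module.End.mem_eigenspace_iff.1 (hX hx), Module.End.mem_eigenspace_iff.1 (hY hy),
    ← real_inner_self_eq_norm_sq]
  simp only [inner_add_left, inner_add_right, real_inner_smul_left, hxy, hyx, mul_zero, add_zero,
    zero_add, real_inner_self_eq_norm_sq, mul_add]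
  exact add_le_add (mul_le_mul_of_nonneg_right (le_max_left _ _) (sq_nonneg _))
    (mul_le_mul_of_nonneg_right (le_max_right _ _) (sq_nonneg _))

/-- The direction of the outgoing connection is expanding. -/
theorem IsRobustCycle.eigenvalue_pos (hc : IsRobustCycle Γ f ξ Sg) (hf : ContDiff ℝ 1 f)
    (hΓ : IsEquivariant Γ f) {j : ZMod M} {X Y : Submodule ℝ R4} {a b : ℝ}
    (hY : Module.finrank ℝ Y = 1) (hXY : X ⟂ Y) (hsup : X ⊔ Y = fixSpace (Sg j))
    (hXa : X ≤ Module.End.eigenspace (fderiv ℝ f (ξ j)).toLinearMap a)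
    (hYb : Y ≤ Module.End.eigenspace (fderiv ℝ f (ξ j)).toLinearMap b) (ha : a < 0) : 0 < b := by
  have hb0 : b ≠ 0 := by
    simpa using (hc.hyperbolic j).2 b (hasComplexEigenvalueOn_of_line hY le_top hYb)
  -- With `b < 0` the linearization is negative definite on `P_j`, so a backward trajectory in `P_j`
  -- tending to `ξ j` is stationary, whereas a connection point differs from `ξ j`.
  by_contra hb
  obtain ⟨x, hx⟩ := hc.connected j
  refine (hc.ne_of_mem_connection hf hx).1 ?_
  have hxP := hc.connection_subset j hx
  obtain ⟨⟨u, rfl, hu, hul⟩, -⟩ := hx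
  refine eq_of_tendsto_atBot_of_negDef (P := fixSpace (Sg j)) (α := -max a b) hf
    (hc.hyperbolic j).1 (hc.mem j) ?_ (fun z hz => ?_) hu
    (fun t ht => integralCurve_mem_fixSpace hf (fun γ hγ => hΓ γ (hc.le j hγ)) hu hxP ht) hul
  · exact neg_pos.2 (max_lt ha (lt_of_le_of_ne (not_lt.1 hb) hb0))
  · rw [neg_neg]
    exact inner_map_self_le_of_eigenspaces hXY hXa hYb (hsup.symm ▸ hz)

end Cycle

end

/-! ### The main theorem. -/

theorem lemma2p1 {M : ℕ} [NeZero M] (Γ : Subgroup O4) [Finite Γ]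
    (f : R4 → R4) (hf : ContDiff ℝ 1 f) (hΓ : IsEquivariant Γ f)
    (ξ : ZMod M → R4) (Sg : ZMod M → Subgroup O4) (hcycle : IsRobustCycle Γ f ξ Sg)
    (hP : ∀ j, Module.finrank ℝ (spaceP Sg j) = 2)
    (hone : ∀ j, ∀ x ∈ (spaceL Sg j : Set R4) \ {0},
      (cycleSet f ξ ∩ connectedComponentIn ((spaceL Sg j : Set R4) \ {0}) x).Subsingleton)
    (j : ZMod M) (hL : spaceL Sg j ≠ ⊥)
    (L V W T : Submodule ℝ R4) (hLj : L = spaceL Sg j) (hVj : V = spaceV Sg j)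
    (hWj : W = spaceW Sg j) (hTj : T = spaceT Sg j)
    (Δ : Subgroup O4) (hΔj : Δ = groupDelta Γ Sg j)
    (J : Module.End ℝ R4) (hJ : J = (fderiv ℝ f (ξ j)).toLinearMap) :
    Module.finrank ℝ L = 1 ∧ Module.finrank ℝ V = 1 ∧
    Module.finrank ℝ W = 1 ∧ Module.finrank ℝ T = 1 ∧
    ∃ r c e t : ℝ, 0 < c ∧ 0 < e ∧
      L ≤ J.eigenspace r ∧ V ≤ J.eigenspace (-c) ∧ W ≤ J.eigenspace e ∧ T ≤ J.eigenspace t ∧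
      (IsIsotypicDecomposition Δ ![L, V, W, T] ∨
        (IsIsotypicDecomposition Δ ![L, V, W ⊔ T] ∧ Module.finrank ℝ ↥(W ⊔ T) = 2 ∧
          (∃ m, 3 ≤ m ∧ ActsAsDihedral Δ (W ⊔ T) m) ∧
          e = t ∧ J.charpoly.rootMultiplicity e = 2) ∨
        (IsIsotypicDecomposition Δ ![L, V ⊔ T, W] ∧ Module.finrank ℝ ↥(V ⊔ T) = 2 ∧
          (∃ m, 3 ≤ m ∧ ActsAsDihedral Δ (V ⊔ T) m) ∧
          -c = t ∧ Module.finrank ℝ ↥(J.eigenspace (-c) ⊓ Lᗮ) = 2 ∧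
          (r ≠ -c → J.charpoly.rootMultiplicity (-c) = 2))) := by
  have h : IsAxisFrame Δ (Sg (j - 1)) (Sg j) L V W T := by
    subst hLj hVj hWj hTj hΔj
    exact hcycle.isAxisFrame hf hP hone hL
  have hΔΓ : Δ ≤ Γ := fun γ hγ => (hΔj ▸ hγ : γ ∈ groupDelta Γ Sg j).1
  have : Finite Δ := Finite.of_injective _ (Subgroup.inclusion_injective hΔΓ)
  have hξ : ξ j ∈ fixSpace Δ := by
    rw [h.fix_eq, ← h.inf_eq]
    exact ⟨hcycle.mem_left j, hcycle.mem j⟩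
  have hcomm : CommutesWith Δ J := hJ ▸
    commutesWith_fderiv (hf.differentiable one_ne_zero) (fun γ hγ => hΓ γ (hΔΓ hγ)) hξ
  obtain ⟨r, hr⟩ := h.exists_le_eigenspace_L hcomm
  obtain ⟨a, ha⟩ := h.exists_le_eigenspace_V hcomm
  obtain ⟨e, he⟩ := h.symm.exists_le_eigenspace_V hcomm
  obtain ⟨t, ht⟩ := h.exists_le_eigenspace_T hcomm
  -- `ξ j` is a sink in `P_{j-1}`, which contains both `L` and `V`; thus the radial eigenvalue is
  -- negative too.
  have hsink {X : Submodule ℝ R4} {b : ℝ} (hX : Module.finrank ℝ X = 1)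
      (hXP : X ≤ fixSpace (Sg (j - 1))) (hXb : X ≤ J.eigenspace b) : b < 0 := by
    have hs := (hcycle.sink (j - 1)).2.2 b
    rw [sub_add_cancel] at hs
    simpa using hs (hasComplexEigenvalueOn_of_line hX hXP (hJ ▸ hXb))
  have hr0 : r < 0 := hsink h.finrank_L h.L_le hr
  have ha0 : a < 0 := hsink h.finrank_V h.V_le ha
  have he0 : 0 < e := hcycle.eigenvalue_pos hf hΓ h.finrank_W h.symm.L_ortho_V h.symm.L_sup_V
    (hJ ▸ hr) (hJ ▸ he) hr0
  have hae : a ≠ e := (ha0.trans he0).ne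
  have hVW := h.V_ortho_W hcomm ha he hae
  have hroots : J.charpoly.roots = {r, a, e, t} := by
    rw [charpoly_eq_of_orthogonal_eigenlines (F := ![L, V, W, T]) (a := ![r, a, e, t]) ?_
      (h.pairwise_ortho hVW) ?_]
    · rw [← Polynomial.roots_multiset_prod_X_sub_C {r, a, e, t}]
      simp [Fin.prod_univ_four, mul_assoc]
    · intro i
      fin_cases i
      exacts [h.finrank_L, h.finrank_V, h.finrank_W, h.finrank_T]
    · intro i
      fin_cases i
      exacts [hr, ha, he, ht]
  have hTeq {b : ℝ} (hb : T ≤ J.eigenspace b) : b = t := by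
    by_contra hne
    exact ne_bot_of_finrank_eq_one h.finrank_T
      (by rw [← inf_eigenspace_eq_bot hne hb, inf_eq_left.2 ht])
  refine ⟨h.finrank_L, h.finrank_V, h.finrank_W, h.finrank_T, r, -a, e, t, neg_pos.2 ha0, he0, hr,
    by rwa [neg_neg], he, ht, ?_⟩
  rw [neg_neg]
  by_cases hV : IsInvariantUnder Δ V
  · by_cases hW : IsInvariantUnder Δ W
    · exact Or.inl (h.isIsotypicDecomposition_four hVW hV hW)
    · have hE := h.eigenspace_inf_orthogonal hVW hcomm ha he hae hV hW
      have het : e = t := hTeq (le_sup_right.trans (hE.symm.le.trans inf_le_left))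
      refine Or.inr (Or.inl ⟨h.isIsotypicDecomposition_three hVW hV hW, h.finrank_sup,
        h.exists_actsAsDihedral_sup hVW hV hW, het, ?_⟩)
      rw [← Polynomial.count_roots, hroots, ← het]
      -- Since `r` and `a` are negative and `e` is positive, only `e` and `t` contribute to the
      -- multiplicity.
      simp [hae.symm, (hr0.trans he0).ne']
  -- The remaining case is the previous one for the frame with the two planes exchanged.
  · have hW := (h.invariant_V_or_invariant_W hcomm ha he hae).resolve_left hV
    have hE := h.symm.eigenspace_inf_orthogonal hVW.symm hcomm he ha hae.symm hW hV
    have hat : a = t := hTeq (le_sup_right.trans (hE.symm.le.trans inf_le_left))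
    refine Or.inr (Or.inr ⟨?_, h.symm.finrank_sup, h.symm.exists_actsAsDihedral_sup hVW.symm hW hV,
      hat, ?_, fun hra => ?_⟩)
    · have hdec := (h.symm.isIsotypicDecomposition_three hVW.symm hW hV).comp_equiv (Equiv.swap 1 2)
      convert hdec using 1
      ext1 i
      fin_cases i <;> rfl
    · rw [hE, h.symm.finrank_sup]
    · rw [← Polynomial.count_roots, hroots, ← hat]
      simp [hae, hra.symm]
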